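/- **Network.** Let $l\ge 0$ and $n_0,\dots,n_{l+1}\ge 0$ be integers and let $N=\sum_{i=1}^{l+1}n_in_{i-1}$. A feed-forward network with $l$ hidden layers has an input layer (layer $l+1$), hidden layers $l,\dots,1$ and an output layer (layer $0$), with $n_i$ nodes in layer $i$. The $j$-th node of hidden layer $i$ carries a function $\sigma^i_j:\mathbb R\to\mathbb R$; put $\sigma^0_j(t)=t$. A weight vector is $\Lambda=[\lambda^i_{j,j'}]\in\mathbb R^N$ ($1\le i\le l+1$, $1\le j\le n_i$, $1\le j'\le n_{i-1}$), where $\lambda^i_{j,j'}$ belongs to the arrow from node $j$ of layer $i$ to node $j'$ of layer $i-1$. All norms are Euclidean. For $\mathbf x\in\mathbb R^{n_{l+1}}$, forward propagation is $$z^{l+1}_j=x_j,\qquad z^i_j=\sigma^i_j(s^i_j),\qquad s^i_j=\sum_{p=1}^{n_{i+1}}\lambda^{i+1}_{p,j}z^{i+1}_p\qquad(i=l,\dots,0),$$ and $F(\mathbf x,\Lambda)=\mathbf z^0\in\mathbb R^{n_0}$ is the function represented by the network. **Assumptions.** Let $0<\rho\le\infty$ and $B_\rho=\{\mathbf x\in\mathbb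 R^{n_{l+1}}:\|\mathbf x\|<\rho\}$ (all of $\mathbb R^{n_{l+1}}$ if $\rho=\infty$). 1. The $\sigma^i_j$ ($1\le i\le l$) are $C^2$ and there is $M>0$ with $|\sigma^i_j|,|(\sigma^i_j)'|,|(\sigma^i_j)''|\le M$ on $\mathbb R$ for all $i,j$. 2. $\mu$ is a Borel probability measure on $B_\rho$, and $\mathbf x(0),\mathbf x(1),\dots$ are independent random variables with values in $B_\rho$ and law $\mu$. 3. $g:B_\rho\to\mathbb R^{n_0}$ satisfies $\|g\|\le G$ for some $G>0$; put $\mathbf y(k)=g(\mathbf x(k))$. 4. $E:\mathbb R^{n_0}\times\mathbb R^{n_0}\to\mathbb R$ is such that $E(\cdot,\mathbf y)$ is $C^2$ whenever $\|\mathbf y\|\le G$, and for every $r>0$ there is $\Gamma_r>0$ with $|E(\mathbf z,\mathbf y)|+\|\nabla_{\mathbf z}E(\mathbf z,\mathbf y)\|+\sqrt{\operatorname{Tr}\big((H_{\mathbf z}E(\mathbf z,\mathbf y))^TH_{\mathbf z}E(\mathbf z,\mathbf y)\big)}\le\Gamma_r$ whenever $\|\mathbf z\|<r$ and $\|\mathbf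 y\|\le G$, where $H_{\mathbf z}E$ is the Hessian of $E$ in $\mathbf z$. For every $\Lambda$ the function $\mathbf x\mapsto E(F(\mathbf x,\Lambda),g(\mathbf x))$ is $\mu$-measurable. 5. $\alpha:\mathbb R^N\to\mathbb R$ is an adequate augmentation with respect to $E,F,g$. That is: $\alpha$ is differentiable; for every $r>0$, $\nabla\alpha$ is Lipschitz on $\{\|\Lambda\|\le r\}$; and, writing $f_{\mathbf x}(\Lambda)=E(F(\mathbf x,\Lambda),g(\mathbf x))+\alpha(\Lambda)$, for every $s>0$ there is $R>0$ with $\Lambda^T\nabla f_{\mathbf x}(\Lambda)\ge0$ whenever $\mathbf x\in B_\rho$, $\|\mathbf x\|\le s$ and $\|\Lambda\|\ge R$. Fix $R_0>0$ such that $\Lambda^T\nabla f_{\mathbf x}(\Lambda)\ge0$ whenever $\mathbf x\in B_\rho$ and $\|\Lambda\|\ge R_0$. 6. $\eta_k>0$ for all $k\ge0$, $\sum_k\eta_k=\infty$ and $\sum_k\eta_k^2<\infty$; put $H=\sup_k\eta_k$. 7. $\Lambda(0)\in\mathbb R^N$ is fixed, $$R_1=\max\Big\{\sqrt{\|\Lambda(0)\|^2+\textstyle\sum_k\eta_k^2},\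 \sqrt{R_0^2+2HR_0+\sum_k\eta_k^2}\Big\},\qquad \Phi=\sup\{\|\nabla f_{\mathbf x}(\Lambda)\|:\mathbf x\in B_\rho,\ \|\Lambda\|<R_1\}.$$ 8. Only if $\rho=\infty$: $\Phi<\infty$, and for every $r>0$ there is $M_r>0$ such that $\|\nabla f_{\mathbf x}(\Lambda)-\nabla f_{\mathbf x}(\Lambda')\|\le M_r\|\Lambda-\Lambda'\|$ for all $\mathbf x$ and all $\|\Lambda\|,\|\Lambda'\|<r$. **Algorithm.** Fix a number $\varphi>0$ with $\varphi\ge\Phi$. Given $\Lambda(k)$, compute $z^i_j$ and $s^i_j$ by forward propagation from $\mathbf x=\mathbf x(k)$ and $\Lambda=\Lambda(k)$, then compute by backward propagation $$d^0_j=\frac{\partial E}{\partial z_j}(\mathbf z^0,\mathbf y(k)),\qquad d^i_j=\sum_{j'=1}^{n_{i-1}}d^{i-1}_{j'}\,(\sigma^{i-1}_{j'})'(s^{i-1}_{j'})\,\lambda^i_{j,j'}(k)\qquad(i=1,\dots,l+1),$$ and update $$\lambda^i_{j,j'}(k+1)=\lambda^i_{j,j'}(k)-\frac{\eta_k}{\varphi}\Big(d^{i-1}_{j'}\,(\sigma^{i-1}_{j'})'(s^{i-1}_{j'})\,z^i_j+\frac{\partial\alpha}{\partial\lambda^i_{j,j'}}(\Lambda(k))\Big).$$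 **Conclusion.** $\Phi<\infty$. The mean error $\mathcal E(\Lambda)=\int_{B_\rho}E(F(\mathbf x,\Lambda),g(\mathbf x))\,d\mu(\mathbf x)$ is well defined (the integrand is integrable) and differentiable on $\mathbb R^N$. For every such $\varphi$: * $\mathcal E(\Lambda(k))+\alpha(\Lambda(k))$ converges almost surely to a finite number; * $\nabla\mathcal E(\Lambda(k))+\nabla\alpha(\Lambda(k))\to\mathbf 0$ almost surely; * almost surely, every limit point of $\{\Lambda(k)\}$ is a stationary point of $\mathcal E+\alpha$. -/

import Mathlib

open MeasureTheory ProbabilityTheory Filter Topology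
open scoped ENNReal

namespace BackProp

/-- A feed-forward network with `hidden` hidden layers. Layer `0` is the output layer and layer
`hidden + 1` (the last index) is the input layer; `width i` is the number of nodes of layer `i`,
and `act i j` is the function labelling the `j`-th node of the hidden layer `i + 1`. -/
structure Network where
  hidden : ℕ
  width : Fin (hidden + 2) → ℕ
  act : (i : Fin hidden) → Fin (width i.succ.castSucc) → ℝ → ℝ

namespace Network

variable (net : Network)

/-- The space of inputs. -/
abbrev Input : Type := EuclideanSpace ℝ (Fin (net.width (Fin.last (net.hidden + 1))))

/-- The space of outputs. -/
abbrev Output : Type := EuclideanSpace ℝ (Fin (net.width 0))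

/-- The index set of the weights: `⟨i, (j, j')⟩` is the arrow from the `j`-th node of layer
`i + 1` to the `j'`-th node of layer `i`. -/
abbrev Arrow : Type :=
  (i : Fin (net.hidden + 1)) × (Fin (net.width i.succ) × Fin (net.width i.castSucc))

/-- The space of weight vectors, with the Euclidean norm. -/
abbrev Weights : Type := EuclideanSpace ℝ net.Arrow

/-- The function applied at the `j`-th node of the non-input layer `i`: the identity on the output
layer `0`, and the labelling function on the hidden layers. -/
def activation : (i : Fin (net.hidden + 1)) → Fin (net.width i.castSucc) → ℝ → ℝ :=
  Fin.cases (fun _ t => t) (fun i j => net.act i j)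

/-- The functions labelling the hidden nodes are `C²`, and they and their first two derivatives
have a common bound. -/
def UniformlyC2Bounded : Prop :=
  (∀ i j, ContDiff ℝ 2 (net.act i j)) ∧
    ∃ M : ℝ, 0 < M ∧ ∀ i j t, |net.act i j t| ≤ M ∧ |deriv (net.act i j) t| ≤ M ∧
      |deriv (deriv (net.act i j)) t| ≤ M

/-- The weighted sum of the data `z` of layer `i + 1` that arrives at the `j`-th node of
layer `i`. -/
def weightedSum (Λ : net.Weights) (i : Fin (net.hidden + 1)) (z : Fin (net.width i.succ) → ℝ)
    (j : Fin (net.width i.castSucc)) : ℝ :=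
  ∑ p, Λ ⟨i, (p, j)⟩ * z p

/-- Forward propagation: `net.forward Λ x i j` is the output datum `z^i_j` of the `j`-th node of
layer `i`. -/
def forward (Λ : net.Weights) (x : net.Input) :
    (i : Fin (net.hidden + 2)) → Fin (net.width i) → ℝ :=
  Fin.reverseInduction (motive := fun i => Fin (net.width i) → ℝ)
    (fun j => x j)
    (fun i z j => net.activation i j (net.weightedSum Λ i z j))

/-- The function represented by the network. -/
def eval (x : net.Input) (Λ : net.Weights) : net.Output :=
  WithLp.toLp 2 (net.forward Λ x 0)

/-- The derivative of the function applied at the `j`-th node of layer `i`, at the weighted sum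
that arrives there. -/
noncomputable def activationDeriv (Λ : net.Weights) (x : net.Input) (i : Fin (net.hidden + 1))
    (j : Fin (net.width i.castSucc)) : ℝ :=
  deriv (net.activation i j) (net.weightedSum Λ i (net.forward Λ x i.succ) j)

/-- Backward propagation, first part: `net.backwardNode E Λ x y i j` is the back-propagated value
of `∂E(z⁰, y) / ∂z^i_j`. -/
noncomputable def backwardNode (E : net.Output → net.Output → ℝ) (Λ : net.Weights)
    (x : net.Input) (y : net.Output) : (i : Fin (net.hidden + 2)) → Fin (net.width i) → ℝ :=
  Fin.induction (motive := fun i => Fin (net.width i) → ℝ)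
    (fun j => gradient (fun z => E z y) (net.eval x Λ) j)
    (fun i d j => ∑ j', d j' * net.activationDeriv Λ x i j' * Λ ⟨i, (j, j')⟩)

/-- Backward propagation, second part: the back-propagated value of the partial derivative of
`E(z⁰, y)` with respect to the weight of the arrow `a`. -/
noncomputable def backwardWeight (E : net.Output → net.Output → ℝ) (Λ : net.Weights)
    (x : net.Input) (y : net.Output) (a : net.Arrow) : ℝ :=
  net.backwardNode E Λ x y a.1.castSucc a.2.2 * net.activationDeriv Λ x a.1 a.2.2 *
    net.forward Λ x a.1.succ a.2.1

/-- The weights produced from the initial weights `Λ₀` and the inputs `x 0, x 1, …` by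
back-propagation with the augmented weight update, the `k`-th step being `η k / φ`. -/
noncomputable def augmentedBP (E : net.Output → net.Output → ℝ) (g : net.Input → net.Output)
    (α : net.Weights → ℝ) (η : ℕ → ℝ) (φ : ℝ) (Λ₀ : net.Weights) (x : ℕ → net.Input) :
    ℕ → net.Weights
  | 0 => Λ₀
  | k + 1 =>
    let Λ := augmentedBP E g α η φ Λ₀ x k
    WithLp.toLp 2 fun a =>
      Λ a - η k / φ * (net.backwardWeight E Λ (x k) (g (x k)) a + gradient α Λ a)

/-- The augmented error `E(F(x, Λ), g(x)) + α(Λ)`. -/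
def augmentedError (E : net.Output → net.Output → ℝ) (g : net.Input → net.Output)
    (α : net.Weights → ℝ) (x : net.Input) (Λ : net.Weights) : ℝ :=
  E (net.eval x Λ) (g x) + α Λ

/-- `α` is an adequate augmentation with respect to `E`, the function of the network, and the
target `g` with domain `D`. -/
structure IsAdequateAugmentation (E : net.Output → net.Output → ℝ) (g : net.Input → net.Output)
    (D : Set net.Input) (α : net.Weights → ℝ) : Prop where
  differentiable : Differentiable ℝ α
  locallyLipschitz : ∀ r : ℝ, 0 < r → ∃ c : ℝ, 0 < c ∧ ∀ Λ Λ' : net.Weights,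
    ‖Λ‖ ≤ r → ‖Λ'‖ ≤ r → ‖gradient α Λ - gradient α Λ'‖ ≤ c * ‖Λ - Λ'‖
  outward : ∀ s : ℝ, 0 < s → ∃ R : ℝ, 0 < R ∧ ∀ x ∈ D, ‖x‖ ≤ s → ∀ Λ : net.Weights, R ≤ ‖Λ‖ →
    0 ≤ inner ℝ Λ (gradient (net.augmentedError E g α x) Λ)

/-- The mean error function `∫_D E(F(x, Λ), g(x)) dμ(x)`. -/
noncomputable def meanError (E : net.Output → net.Output → ℝ) (g : net.Input → net.Output)
    (D : Set net.Input) (μ : Measure net.Input) (Λ : net.Weights) : ℝ :=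
  ∫ x in D, E (net.eval x Λ) (g x) ∂μ

/-- The radius `R₁` determined by the initial weights, the radius `R₀` and the step sizes. -/
noncomputable def radius (Λ₀ : net.Weights) (R₀ : ℝ) (η : ℕ → ℝ) : ℝ :=
  max (√(‖Λ₀‖ ^ 2 + ∑' k, η k ^ 2)) (√(R₀ ^ 2 + 2 * (⨆ k, η k) * R₀ + ∑' k, η k ^ 2))

/-- The supremum, in `[0, ∞]`, of the norm of the gradient with respect to `Λ` of the augmented
error, over `x ∈ D` and `‖Λ‖ < R`. -/
noncomputable def gradientSup (E : net.Output → net.Output → ℝ) (g : net.Input → net.Output)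
    (D : Set net.Input) (α : net.Weights → ℝ) (R : ℝ) : ℝ≥0∞ :=
  ⨆ x ∈ D, ⨆ Λ ∈ Metric.ball (0 : net.Weights) R, ‖gradient (net.augmentedError E g α x) Λ‖ₑ

end Network

/-- The Hessian matrix of a real function on a Euclidean space. -/
noncomputable def hessian {m : ℕ} (u : EuclideanSpace ℝ (Fin m) → ℝ)
    (z : EuclideanSpace ℝ (Fin m)) : Matrix (Fin m) (Fin m) ℝ :=
  Matrix.of fun i j =>
    fderiv ℝ (fun w => fderiv ℝ u w (EuclideanSpace.single j 1)) z (EuclideanSpace.single i 1)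

/-- `E` is `C²`-bounded in its first argument, for second arguments of norm at most `G`. -/
def C2BoundedError {m : ℕ} (E : EuclideanSpace ℝ (Fin m) → EuclideanSpace ℝ (Fin m) → ℝ)
    (G : ℝ) : Prop :=
  (∀ y, ‖y‖ ≤ G → ContDiff ℝ 2 (fun z => E z y)) ∧
    ∀ r : ℝ, 0 < r → ∃ Γ : ℝ, 0 < Γ ∧ ∀ z y, ‖z‖ < r → ‖y‖ ≤ G →
      |E z y| + ‖gradient (fun w => E w y) z‖ +
        √(Matrix.trace ((hessian (fun w => E w y) z).transpose * hessian (fun w => E w y) z)) ≤ Γ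

end BackProp

/-! Back-propagation with an adequate augmentation is stochastic gradient descent for the mean of
the augmented errors `f x = E (F(x, ·), g x) + α`, and the theorem follows from three facts.

* *The update is a gradient step* (`gradient_error_eval_apply`). If `dz i` is the derivative of the
  data of layer `i` in a direction `δ` of the weight space, then the pairing of `dz i` with the
  back-propagated node derivatives of layer `i` exceeds the pairing for layer `i + 1` by the
  pairing of `δ` with the back-propagated weight derivatives between the two layers. The sum over
  the layers telescopes.
* *The iterates stay in the ball of radius `R₁`* (`norm_lt_of_outward`), where the sampled
  gradients are bounded by `φ` and Lipschitz, uniformly in `x`. For bounded inputs these uniform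
  bounds come from compactness, as the network is `C²` in inputs and weights together, and the
  derivative of `E` in the first variable is Lipschitz uniformly in the second one. For unbounded
  inputs the bounds on the gradient are hypotheses, and those on the values follow because the
  network with zero weights vanishes, so that `f x 0` is bounded. The same bounds give the
  differentiability of the mean error.
* *Stochastic gradient descent converges* (`ae_tendsto_of_stochastic_gradient_descent`). Let `J` be
  the mean of the `f x`. Taylor expansion along one step, of length at most `η k`, gives
  `J (v (k + 1)) = J (v k) - η k / φ * ‖∇J (v k)‖ ^ 2 + D k + O(η k ^ 2)`, where `D k` is a
  martingale difference of size `O(η k)`. The sums of the `D k` form a martingale that is bounded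
  in `L²`, hence converge almost surely, and since `J` is bounded on the ball,
  `∑ η k * ‖∇J (v k)‖ ^ 2` converges and so does `J (v k)`. As `‖∇J (v k)‖` changes by `O(η k)` in
  one step while `∑ η k` diverges, it tends to `0` (`tendsto_zero_of_summable_mul_sq`).

The target `g` need not be measurable, so that the sampled gradient is measurable in `x` only up to
a null set depending on the weights. By continuity in the weights a single null set suffices
(`exists_measurable_indicator_gradient`), and almost surely no sample falls into it. -/

namespace BackProp

/-! ### Two deterministic lemmas -/

/-- The cubes `a k ^ 3` have summable increments, because `|a (k + 1) ^ 3 - a k ^ 3|` is at most a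
constant times `η k * a k ^ 2 + η k ^ 2`. Hence they converge, and their limit is `0` since the
step sizes are not summable. -/
theorem tendsto_zero_of_summable_mul_sq {a η : ℕ → ℝ} {L : ℝ} (ha : ∀ k, 0 ≤ a k)
    (hη : ∀ k, 0 ≤ η k) (hηsum : ¬ Summable η) (hηsq : Summable fun k => η k ^ 2)
    (hs : Summable fun k => η k * a k ^ 2) (hL : ∀ k, |a (k + 1) - a k| ≤ L * η k) :
    Tendsto a atTop (𝓝 0) := by
  obtain ⟨b, hb⟩ : ∃ b, ∀ k, η k ≤ b := by
    obtain ⟨b, hb⟩ := hηsq.tendsto_atTop_zero.bddAbove_range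
    refine ⟨b + 1, fun k => ?_⟩
    have := hb ⟨k, rfl⟩
    nlinarith [sq_nonneg (η k - 1)]
  have hcauchy : CauchySeq fun k => a k ^ 3 := by
    refine cauchySeq_of_summable_dist (Summable.of_nonneg_of_le (fun _ => dist_nonneg)
      (fun k => ?_) ((hs.mul_left (5 * |L|)).add (hηsq.mul_left (3 * |L| * |L| ^ 2 * b))))
    have h1 : |a (k + 1) - a k| ≤ |L| * η k :=
      (hL k).trans (mul_le_mul_of_nonneg_right (le_abs_self L) (hη k))
    have h2 : a (k + 1) ≤ a k + |L| * η k := by linarith [le_abs_self (a (k + 1) - a k)]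
    have ht : 0 ≤ |L| * η k := mul_nonneg (abs_nonneg L) (hη k)
    have h3 : a (k + 1) ^ 2 + a (k + 1) * a k + a k ^ 2 ≤ 5 * a k ^ 2 + 3 * (|L| * η k) ^ 2 := by
      have e1 : a (k + 1) ^ 2 ≤ (a k + |L| * η k) ^ 2 := pow_le_pow_left₀ (ha _) h2 2
      have e2 : a (k + 1) * a k ≤ (a k + |L| * η k) * a k := mul_le_mul_of_nonneg_right h2 (ha k)
      nlinarith [sq_nonneg (a k - |L| * η k)]
    have h4 : 0 ≤ a (k + 1) ^ 2 + a (k + 1) * a k + a k ^ 2 := by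
      have := mul_nonneg (ha (k + 1)) (ha k)
      positivity
    rw [Real.dist_eq, abs_sub_comm]
    calc |a k.succ ^ 3 - a k ^ 3|
        = |a (k + 1) - a k| * (a (k + 1) ^ 2 + a (k + 1) * a k + a k ^ 2) := by
          rw [← abs_of_nonneg h4, ← abs_mul]; congr 1; ring
      _ ≤ |L| * η k * (5 * a k ^ 2 + 3 * (|L| * η k) ^ 2) := mul_le_mul h1 h3 h4 ht
      _ = 5 * |L| * (η k * a k ^ 2) + 3 * |L| * |L| ^ 2 * η k * η k ^ 2 := by ring
      _ ≤ 5 * |L| * (η k * a k ^ 2) + 3 * |L| * |L| ^ 2 * b * η k ^ 2 := by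
          gcongr; exact hb k
  obtain ⟨c, hc⟩ := cauchySeq_tendsto_of_complete hcauchy
  have hc0 : 0 ≤ c := ge_of_tendsto' hc fun k => pow_nonneg (ha k) 3
  rcases hc0.eq_or_lt with rfl | hc0
  · rw [Metric.tendsto_atTop] at hc ⊢
    intro ε hε
    obtain ⟨N, hN⟩ := hc (ε ^ 3) (by positivity)
    refine ⟨N, fun n hn => ?_⟩
    have := hN n hn
    rw [Real.dist_eq, sub_zero, abs_of_nonneg (pow_nonneg (ha n) 3)] at this
    rw [Real.dist_eq, sub_zero, abs_of_nonneg (ha n)]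
    exact lt_of_pow_lt_pow_left₀ 3 hε.le this
  · -- `a k` is eventually bounded below by a positive number, so that `η` would be summable
    exfalso
    apply hηsum
    set δ := min 1 (c / 2) with hδ
    have hδ0 : 0 < δ := lt_min one_pos (half_pos hc0)
    have hev : ∀ᶠ k in atTop, δ ≤ a k := by
      filter_upwards [hc.eventually (lt_mem_nhds (half_lt_self hc0))] with k hk
      by_contra! hlt
      have h1 : a k < 1 := hlt.trans_le (min_le_left _ _)
      have h2 : a k < c / 2 := hlt.trans_le (min_le_right _ _)
      have h3 : a k ^ 3 ≤ a k := by
        have := pow_le_pow_of_le_one (ha k) h1.le (show 1 ≤ 3 by norm_num)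
        simpa using this
      linarith
    have hsum := hs.mul_left ((δ ^ 2)⁻¹)
    refine Summable.of_norm_bounded_eventually_nat hsum ?_
    filter_upwards [hev] with k hk
    rw [Real.norm_of_nonneg (hη k)]
    have : δ ^ 2 ≤ a k ^ 2 := pow_le_pow_left₀ hδ0.le hk 2
    rw [inv_mul_eq_div, le_div_iff₀ (by positivity)]
    exact mul_le_mul_of_nonneg_left this (hη k)

/-- First-order Taylor estimate on a ball where the gradient is Lipschitz. -/
theorem abs_sub_sub_inner_le_of_lipschitz_gradient {V : Type*} [NormedAddCommGroup V]
    [InnerProductSpace ℝ V] [CompleteSpace V] {J : V → ℝ} {G : V → V} {R L : ℝ} (hL : 0 ≤ L)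
    (hJ : ∀ v, HasGradientAt J (G v) v)
    (hG : ∀ v w, ‖v‖ < R → ‖w‖ < R → ‖G v - G w‖ ≤ L * ‖v - w‖) {v w : V} (hv : ‖v‖ < R)
    (hw : ‖w‖ < R) : |J w - J v - inner ℝ (G v) (w - v)| ≤ L * ‖w - v‖ ^ 2 := by
  have hsub : segment ℝ v w ⊆ Metric.ball (0 : V) R :=
    (convex_ball _ _).segment_subset (by simpa using hv) (by simpa using hw)
  have key := Convex.norm_image_sub_le_of_norm_hasFDerivWithin_le' (𝕜 := ℝ) (f := J)
    (f' := fun u => InnerProductSpace.toDual ℝ V (G u)) (φ := InnerProductSpace.toDual ℝ V (G v))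
    (C := L * ‖w - v‖) (s := segment ℝ v w)
    (fun u _ => (hasGradientAt_iff_hasFDerivAt.1 (hJ u)).hasFDerivWithinAt) ?_
    (convex_segment v w) (left_mem_segment ℝ v w) (right_mem_segment ℝ v w)
  · simpa [InnerProductSpace.toDual_apply_apply, pow_two, mul_assoc] using key
  · intro u hu
    rw [← map_sub, LinearIsometryEquiv.norm_map]
    have huR : ‖u‖ < R := by simpa using hsub hu
    refine (hG u v huR hv).trans (mul_le_mul_of_nonneg_left ?_ hL)
    exact norm_sub_le_of_mem_segment hu

/-! ### Convergence of sums of orthogonal increments -/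

/-- A sum of bounded martingale differences with summable squared bounds converges almost surely:
its partial sums form a martingale that is bounded in `L²`. -/
theorem ae_exists_tendsto_sum_of_orthogonal {Ω : Type*} {m0 : MeasurableSpace Ω} {P : Measure Ω}
    [IsProbabilityMeasure P] {ℱ : Filtration ℕ m0} {D : ℕ → Ω → ℝ} {c : ℕ → ℝ}
    (hD : ∀ k, StronglyMeasurable[ℱ (k + 1)] (D k)) (hc : ∀ k ω, |D k ω| ≤ c k)
    (hcs : Summable fun k => c k ^ 2)
    (hz : ∀ k, ∀ w : Ω → ℝ, StronglyMeasurable[ℱ k] w → (∃ C, ∀ ω, |w ω| ≤ C) →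
      ∫ ω, w ω * D k ω ∂P = 0) :
    ∀ᵐ ω ∂P, ∃ l, Tendsto (fun n => ∑ k ∈ Finset.range n, D k ω) atTop (𝓝 l) := by
  set S : ℕ → Ω → ℝ := fun n ω => ∑ k ∈ Finset.range n, D k ω with hS
  have hSsucc : ∀ n ω, S (n + 1) ω = S n ω + D n ω := fun n ω => Finset.sum_range_succ _ _
  have hSm : ∀ n, StronglyMeasurable[ℱ n] (S n) := by
    intro n
    induction n with
    | zero => simpa [hS] using stronglyMeasurable_const
    | succ n ih =>
      have : S (n + 1) = S n + D n := funext (hSsucc n)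
      rw [this]
      exact (ih.mono (ℱ.mono n.le_succ)).add (hD n)
  have hSb : ∀ n ω, |S n ω| ≤ ∑ k ∈ Finset.range n, c k := fun n ω =>
    (Finset.abs_sum_le_sum_abs _ _).trans (Finset.sum_le_sum fun k _ => hc k ω)
  have hSm0 : ∀ n, AEStronglyMeasurable (S n) P := fun n =>
    ((hSm n).mono (ℱ.le n)).aestronglyMeasurable
  have hDm0 : ∀ n, AEStronglyMeasurable (D n) P := fun n =>
    ((hD n).mono (ℱ.le _)).aestronglyMeasurable
  have hSi : ∀ n, Integrable (S n) P := fun n =>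
    Integrable.of_bound (hSm0 n) _ (ae_of_all _ (hSb n))
  have hDi : ∀ n, Integrable (D n) P := fun n =>
    Integrable.of_bound (hDm0 n) _ (ae_of_all _ (hc n))
  have hS2i : ∀ n, Integrable (fun ω => S n ω ^ 2) P := fun n => by
    refine Integrable.of_bound ((hSm0 n).pow 2) ((∑ k ∈ Finset.range n, c k) ^ 2)
      (ae_of_all _ fun ω => ?_)
    rw [norm_pow]
    exact pow_le_pow_left₀ (norm_nonneg _) (hSb n ω) 2
  have hD2i : ∀ n, Integrable (fun ω => D n ω ^ 2) P := fun n => by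
    refine Integrable.of_bound ((hDm0 n).pow 2) (c n ^ 2) (ae_of_all _ fun ω => ?_)
    rw [norm_pow]
    exact pow_le_pow_left₀ (norm_nonneg _) (hc n ω) 2
  have hSDi : ∀ n, Integrable (fun ω => S n ω * D n ω) P := fun n =>
    (hDi n).bdd_mul (hSm0 n) (ae_of_all _ (hSb n))
  have hmart : Martingale S ℱ P := by
    refine martingale_of_setIntegral_eq_succ hSm hSi fun i s hs => ?_
    have hs0 : MeasurableSet s := ℱ.le i s hs
    have h0 := hz i (s.indicator fun _ => 1)
      (StronglyMeasurable.indicator stronglyMeasurable_const hs) ⟨1, fun ω => by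
        by_cases h : ω ∈ s <;> simp [h]⟩
    have h1 : ∫ ω in s, D i ω ∂P = 0 := by
      rw [← integral_indicator hs0, ← h0]
      refine integral_congr_ae (ae_of_all _ fun ω => ?_)
      by_cases h : ω ∈ s <;> simp [h]
    simp only [hSsucc]
    rw [integral_add (hSi i).integrableOn (hDi i).integrableOn, h1, add_zero]
  have hL2 : ∀ n, ∫ ω, S n ω ^ 2 ∂P ≤ ∑ k ∈ Finset.range n, c k ^ 2 := by
    intro n
    induction n with
    | zero => simp [hS]
    | succ n ih =>
      have h1 : ∫ ω, S (n + 1) ω ^ 2 ∂P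
          = ∫ ω, (S n ω ^ 2 + 2 * (S n ω * D n ω)) + D n ω ^ 2 ∂P := by
        refine integral_congr_ae (ae_of_all _ fun ω => ?_)
        simp only [hSsucc]; ring
      have h2 : Integrable (fun ω => S n ω ^ 2 + 2 * (S n ω * D n ω)) P :=
        (hS2i n).add ((hSDi n).const_mul 2)
      rw [h1, integral_add h2 (hD2i n),
        integral_add (hS2i n) ((hSDi n).const_mul 2), integral_const_mul,
        hz n (S n) (hSm n) ⟨_, hSb n⟩, Finset.sum_range_succ, mul_zero, add_zero]
      refine add_le_add ih ?_
      have : ∫ ω, D n ω ^ 2 ∂P ≤ ∫ _, c n ^ 2 ∂P :=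
        integral_mono (hD2i n) (integrable_const _) fun ω => by
          rw [← sq_abs]; exact pow_le_pow_left₀ (abs_nonneg _) (hc n ω) 2
      simpa using this
  have htot : 0 ≤ ∑' k, c k ^ 2 := tsum_nonneg fun k => sq_nonneg _
  refine Submartingale.exists_ae_tendsto_of_bdd hmart.submartingale
    (R := ⟨1 + ∑' k, c k ^ 2, by positivity⟩) fun n => ?_
  rw [eLpNorm_one_eq_lintegral_enorm, ← ofReal_integral_norm_eq_lintegral_enorm (hSi n)]
  refine ENNReal.ofReal_le_of_le_toReal ?_
  change ∫ ω, ‖S n ω‖ ∂P ≤ 1 + ∑' k, c k ^ 2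
  calc ∫ ω, ‖S n ω‖ ∂P ≤ ∫ ω, 1 + S n ω ^ 2 ∂P :=
        integral_mono (hSi n).norm ((integrable_const _).add (hS2i n)) fun ω => by
          change |S n ω| ≤ 1 + S n ω ^ 2
          nlinarith [sq_nonneg (|S n ω| - 1), sq_abs (S n ω)]
    _ = 1 + ∫ ω, S n ω ^ 2 ∂P := by
        rw [integral_add (integrable_const _) (hS2i n)]; simp
    _ ≤ 1 + ∑' k, c k ^ 2 := by
        gcongr
        exact (hL2 n).trans (hcs.sum_le_tsum _ fun _ _ => sq_nonneg _)

/-! ### Stochastic gradient descent -/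

section StochasticGradient

variable {Ω 𝒳 V : Type*} {m m0 : MeasurableSpace Ω} {P : Measure Ω}
  [MeasurableSpace 𝒳] {μ : Measure 𝒳} [IsProbabilityMeasure μ]
  [NormedAddCommGroup V] [InnerProductSpace ℝ V] [FiniteDimensional ℝ V] [MeasurableSpace V]
  [BorelSpace V] {h : V → 𝒳 → V}

/-- Given the past `m`, the fluctuation of the sampled gradient `h Y X` around its mean has mean
zero, since the sample `X` is independent of `m` while the iterate `Y` is determined by `m`. -/
theorem integral_mul_inner_fluctuation_eq_zero [IsProbabilityMeasure P] {R φ : ℝ}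
    (hh : Measurable (Function.uncurry h))
    (hint : ∀ v, Integrable (h v) μ) (hbdd : ∀ v x, ‖v‖ < R → ‖h v x‖ ≤ φ)
    (hm : m ≤ m0) {X : Ω → 𝒳} (hX : Measurable X)
    (hlaw : P.map X = μ) (hindep : Indep m (MeasurableSpace.comap X inferInstance) P)
    {Y : Ω → V} (hY : Measurable[m] Y) (hYR : ∀ ω, ‖Y ω‖ < R) {w : Ω → ℝ}
    (hw : Measurable[m] w) (hwb : ∃ C, ∀ ω, |w ω| ≤ C) :
    ∫ ω, w ω * inner ℝ (∫ x, h (Y ω) x ∂μ) ((∫ x, h (Y ω) x ∂μ) - h (Y ω) (X ω)) ∂P = 0 := by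
  have hGm : Measurable fun v => ∫ x, h v x ∂μ :=
    (hh.stronglyMeasurable.integral_prod_right (f := h) (ν := μ)).measurable
  have hGb : ∀ v, ‖v‖ < R → ‖∫ x, h v x ∂μ‖ ≤ φ := fun v hv => by
    simpa using norm_integral_le_of_norm_le_const (μ := μ) (ae_of_all _ fun x => hbdd v x hv)
  set ψ : (ℝ × V) × 𝒳 → ℝ := fun p =>
    p.1.1 * inner ℝ (∫ x, h p.1.2 x ∂μ) ((∫ x, h p.1.2 x ∂μ) - h p.1.2 p.2) with hψ
  have hψm : Measurable ψ := by
    have e1 : Measurable fun p : (ℝ × V) × 𝒳 => ∫ x, h p.1.2 x ∂μ :=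
      hGm.comp (measurable_snd.comp measurable_fst)
    have e2 : Measurable fun p : (ℝ × V) × 𝒳 => h p.1.2 p.2 :=
      hh.comp ((measurable_snd.comp measurable_fst).prodMk measurable_snd)
    exact (measurable_fst.comp measurable_fst).mul (e1.inner (e1.sub e2))
  have hZ : Measurable[m] fun ω => (w ω, Y ω) := hw.prodMk hY
  have hZ0 : Measurable fun ω => (w ω, Y ω) := hZ.mono hm le_rfl
  have hZX : IndepFun (fun ω => (w ω, Y ω)) X P := by
    rw [IndepFun_iff_Indep]
    exact indep_of_indep_of_le_left hindep hZ.comap_le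
  have hmap := (indepFun_iff_map_prod_eq_prod_map_map hZ0.aemeasurable hX.aemeasurable).1 hZX
  rw [hlaw] at hmap
  have hpair : Measurable fun ω => ((w ω, Y ω), X ω) := hZ0.prodMk hX
  obtain ⟨C, hC⟩ := hwb
  have hψint : Integrable ψ ((P.map fun ω => (w ω, Y ω)).prod μ) := by
    rw [← hmap, integrable_map_measure hψm.aestronglyMeasurable hpair.aemeasurable]
    refine Integrable.of_bound (hψm.comp hpair).aestronglyMeasurable (C * (φ * (φ + φ)))
      (ae_of_all _ fun ω => ?_)
    simp only [hψ, Function.comp, norm_mul]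
    refine mul_le_mul (hC ω) ?_ (norm_nonneg _) ((abs_nonneg _).trans (hC ω))
    have h1 := hGb _ (hYR ω)
    refine (norm_inner_le_norm _ _).trans (mul_le_mul h1 ?_ (norm_nonneg _)
      ((norm_nonneg _).trans h1))
    exact (norm_sub_le _ _).trans (add_le_add h1 (hbdd _ _ (hYR ω)))
  calc ∫ ω, w ω * inner ℝ (∫ x, h (Y ω) x ∂μ) ((∫ x, h (Y ω) x ∂μ) - h (Y ω) (X ω)) ∂P
      = ∫ p, ψ p ∂(P.map fun ω => ((w ω, Y ω), X ω)) := by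
        rw [integral_map hpair.aemeasurable hψm.aestronglyMeasurable]
    _ = ∫ z, ∫ x, ψ (z, x) ∂μ ∂(P.map fun ω => (w ω, Y ω)) := by
        rw [hmap, integral_prod _ hψint]
    _ = 0 := by
        refine integral_eq_zero_of_ae (ae_of_all _ fun z => ?_)
        simp only [hψ, Pi.zero_apply]
        have e : Integrable (fun x => (∫ x, h z.2 x ∂μ) - h z.2 x) μ :=
          (integrable_const _).sub (hint z.2)
        rw [integral_const_mul, integral_inner e, integral_sub (integrable_const _) (hint z.2)]
        simp

/-- The filtration generated by the samples taken strictly before time `n`, which are independent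
of the `n`-th sample. -/
theorem exists_filtration_of_past {X : ℕ → Ω → 𝒳} (hX : ∀ k, Measurable (X k))
    (hindep : iIndepFun X P) : ∃ ℱ : Filtration ℕ m0, (∀ k, Measurable[ℱ (k + 1)] (X k)) ∧
      ∀ k, Indep (ℱ k) (MeasurableSpace.comap (X k) inferInstance) P := by
  refine ⟨⟨fun n => ⨆ i ∈ Set.Iio n, MeasurableSpace.comap (X i) inferInstance,
    fun _ _ hnm => biSup_mono fun _ hi => lt_of_lt_of_le hi hnm,
    fun _ => iSup₂_le fun i _ => (hX i).comap_le⟩, fun k => ?_, fun k => ?_⟩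
  · refine Measurable.mono (comap_measurable (X k)) ?_ le_rfl
    exact le_iSup₂_of_le (f := fun i (_ : i ∈ Set.Iio (k + 1)) =>
      MeasurableSpace.comap (X i) inferInstance) k (Nat.lt_succ_self k) le_rfl
  · have := indep_iSup_of_disjoint (fun i => (hX i).comap_le) hindep.iIndep
      (S := Set.Iio k) (T := {k}) (by simp)
    rw [iSup_singleton] at this
    exact this

/-- Stochastic gradient descent for `J` with gradient `v ↦ ∫ h v x ∂μ`, driven by independent
samples, with iterates in a ball on which the gradient is Lipschitz and the sampled gradients are
bounded: almost surely the values of `J` converge and its gradients tend to `0`. -/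
theorem ae_tendsto_of_stochastic_gradient_descent [IsProbabilityMeasure P] {J : V → ℝ}
    {R L φ : ℝ} {η : ℕ → ℝ} {X : ℕ → Ω → 𝒳} {v : ℕ → Ω → V} {v₀ : V}
    (hh : Measurable (Function.uncurry h)) (hint : ∀ v, Integrable (h v) μ)
    (hJ : ∀ v, HasGradientAt J (∫ x, h v x ∂μ) v) (hL : 0 ≤ L)
    (hLip : ∀ v w, ‖v‖ < R → ‖w‖ < R →
      ‖(∫ x, h v x ∂μ) - ∫ x, h w x ∂μ‖ ≤ L * ‖v - w‖)
    (hbdd : ∀ v x, ‖v‖ < R → ‖h v x‖ ≤ φ)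
    (hη : ∀ k, 0 ≤ η k) (hηsum : ¬ Summable η) (hηsq : Summable fun k => η k ^ 2)
    (hX : ∀ k, Measurable (X k)) (hindep : iIndepFun X P) (hlaw : ∀ k, P.map (X k) = μ)
    (hv₀ : ∀ ω, v 0 ω = v₀)
    (hv : ∀ k ω, v (k + 1) ω = v k ω - η k • h (v k ω) (X k ω))
    (hR : ∀ k ω, ‖v k ω‖ < R) :
    ∀ᵐ ω ∂P, (∃ c, Tendsto (fun k => J (v k ω)) atTop (𝓝 c)) ∧
      Tendsto (fun k => ∫ x, h (v k ω) x ∂μ) atTop (𝓝 0) := by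
  set G : V → V := fun v => ∫ x, h v x ∂μ with hG
  have hGm : Measurable G :=
    (hh.stronglyMeasurable.integral_prod_right (f := h) (ν := μ)).measurable
  have hGb : ∀ v, ‖v‖ < R → ‖G v‖ ≤ φ := fun v hv => by
    simpa using norm_integral_le_of_norm_le_const (μ := μ) (ae_of_all _ fun x => hbdd v x hv)
  obtain ⟨ℱ, hXm, hind⟩ := exists_filtration_of_past hX hindep
  have hvm : ∀ k, Measurable[ℱ k] (v k) := by
    intro k
    induction k with
    | zero =>
      have : v 0 = fun _ => v₀ := funext hv₀
      rw [this]; exact measurable_const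
    | succ k ih =>
      have e : v (k + 1) = fun ω => v k ω - η k • h (v k ω) (X k ω) := funext (hv k)
      have ih' : Measurable[ℱ (k + 1)] (v k) := ih.mono (ℱ.mono k.le_succ) le_rfl
      rw [e]
      exact ih'.sub ((hh.comp (ih'.prodMk (hXm k))).const_smul (η k))
  set D : ℕ → Ω → ℝ := fun k ω =>
    η k * inner ℝ (G (v k ω)) (G (v k ω) - h (v k ω) (X k ω)) with hD
  have hDm : ∀ k, StronglyMeasurable[ℱ (k + 1)] (D k) := fun k => by
    have ih' : Measurable[ℱ (k + 1)] (v k) := (hvm k).mono (ℱ.mono k.le_succ) le_rfl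
    have e1 : Measurable[ℱ (k + 1)] fun ω => G (v k ω) := hGm.comp ih'
    have e2 : Measurable[ℱ (k + 1)] fun ω => h (v k ω) (X k ω) := hh.comp (ih'.prodMk (hXm k))
    exact ((e1.inner (e1.sub e2)).const_mul (η k)).stronglyMeasurable
  have hDb : ∀ k ω, |D k ω| ≤ η k * (φ * (φ + φ)) := fun k ω => by
    have h1 := hGb _ (hR k ω)
    rw [hD, abs_mul, abs_of_nonneg (hη k)]
    refine mul_le_mul_of_nonneg_left ?_ (hη k)
    refine (abs_real_inner_le_norm _ _).trans (mul_le_mul h1 ?_ (norm_nonneg _)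
      ((norm_nonneg _).trans h1))
    exact (norm_sub_le _ _).trans (add_le_add h1 (hbdd _ _ (hR k ω)))
  have hDz : ∀ k, ∀ w : Ω → ℝ, StronglyMeasurable[ℱ k] w → (∃ C, ∀ ω, |w ω| ≤ C) →
      ∫ ω, w ω * D k ω ∂P = 0 := fun k w hw hwb => by
    have h0 := integral_mul_inner_fluctuation_eq_zero (w := w) (Y := v k) (X := X k) hh hint hbdd
      (ℱ.le k) (hX k) (hlaw k) (hind k) (hvm k) (hR k) hw.measurable hwb
    have h1 : ∀ ω, w ω * D k ω
        = η k * (w ω * inner ℝ (G (v k ω)) (G (v k ω) - h (v k ω) (X k ω))) := fun ω => by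
      simp only [hD]; ring
    simp only [h1]
    rw [integral_const_mul, h0, mul_zero]
  have hcs : Summable fun k => (η k * (φ * (φ + φ))) ^ 2 := by
    simp_rw [mul_pow (η _)]
    exact hηsq.mul_right _
  have hmart : ∀ᵐ ω ∂P, ∃ l, Tendsto (fun n => ∑ k ∈ Finset.range n, D k ω) atTop (𝓝 l) :=
    ae_exists_tendsto_sum_of_orthogonal (ℱ := ℱ) (D := D) hDm hDb hcs hDz
  filter_upwards [hmart] with ω hω
  obtain ⟨l, hl⟩ := hω
  have hstep : ∀ k, ‖v (k + 1) ω - v k ω‖ ≤ η k * φ := fun k => by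
    rw [hv, sub_sub_cancel_left, norm_neg, norm_smul, Real.norm_of_nonneg (hη k)]
    exact mul_le_mul_of_nonneg_left (hbdd _ _ (hR k ω)) (hη k)
  -- the remainder in the Taylor expansion of `J` along one step
  set r : ℕ → ℝ := fun k =>
    J (v (k + 1) ω) - J (v k ω) - inner ℝ (G (v k ω)) (v (k + 1) ω - v k ω) with hr
  have hrb : ∀ k, |r k| ≤ L * φ ^ 2 * η k ^ 2 := fun k => by
    refine (abs_sub_sub_inner_le_of_lipschitz_gradient hL hJ hLip (hR k ω)
      (hR (k + 1) ω)).trans ?_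
    calc L * ‖v (k + 1) ω - v k ω‖ ^ 2 ≤ L * (η k * φ) ^ 2 := by gcongr; exact hstep k
      _ = L * φ ^ 2 * η k ^ 2 := by ring
  have hrs : Summable r := Summable.of_norm_bounded (hηsq.mul_left (L * φ ^ 2)) hrb
  have hdecomp : ∀ n, ∑ k ∈ Finset.range n, η k * ‖G (v k ω)‖ ^ 2
      = J v₀ - J (v n ω) + ∑ k ∈ Finset.range n, D k ω + ∑ k ∈ Finset.range n, r k := by
    intro n
    induction n with
    | zero => simp [hv₀]
    | succ n ih =>
      rw [Finset.sum_range_succ, Finset.sum_range_succ, Finset.sum_range_succ, ih]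
      simp only [hD, hr, hv n, sub_sub_cancel_left, inner_smul_right,
        inner_sub_right, real_inner_self_eq_norm_sq]
      ring
  have hJc : Continuous J :=
    continuous_iff_continuousAt.2 fun v => (hasGradientAt_iff_hasFDerivAt.1 (hJ v)).continuousAt
  obtain ⟨B, hB⟩ := (isCompact_closedBall (0 : V) R).exists_bound_of_continuousOn hJc.continuousOn
  obtain ⟨B₁, hB₁⟩ := hl.bddAbove_range
  obtain ⟨B₂, hB₂⟩ := hrs.hasSum.tendsto_sum_nat.bddAbove_range
  have hsum : Summable fun k => η k * ‖G (v k ω)‖ ^ 2 := by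
    refine summable_of_sum_range_le (c := J v₀ + B + B₁ + B₂)
      (fun k => mul_nonneg (hη k) (sq_nonneg _)) fun n => ?_
    have h1 := hB (v n ω) (by simpa using (hR n ω).le)
    have h2 : ∑ k ∈ Finset.range n, D k ω ≤ B₁ := hB₁ ⟨n, rfl⟩
    have h3 : ∑ k ∈ Finset.range n, r k ≤ B₂ := hB₂ ⟨n, rfl⟩
    rw [hdecomp]
    linarith [neg_le_of_abs_le h1]
  refine ⟨⟨J v₀ + l + ∑' k, r k - ∑' k, η k * ‖G (v k ω)‖ ^ 2, ?_⟩, ?_⟩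
  · refine (((tendsto_const_nhds.add hl).add hrs.hasSum.tendsto_sum_nat).sub
      hsum.hasSum.tendsto_sum_nat).congr fun n => ?_
    rw [hdecomp]; ring
  · rw [tendsto_zero_iff_norm_tendsto_zero]
    refine tendsto_zero_of_summable_mul_sq (L := L * φ) (fun k => norm_nonneg _) hη hηsum hηsq
      hsum fun k => ?_
    refine (abs_norm_sub_norm_le _ _).trans ((hLip _ _ (hR _ ω) (hR _ ω)).trans ?_)
    calc L * ‖v (k + 1) ω - v k ω‖ ≤ L * (η k * φ) := by gcongr; exact hstep k
      _ = L * φ * η k := by ring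

end StochasticGradient

/-! ### Calculus of the network -/

theorem gradient_apply_eq_fderiv_single {ι : Type*} [Fintype ι] [DecidableEq ι]
    (u : EuclideanSpace ℝ ι → ℝ) (z : EuclideanSpace ℝ ι) (a : ι) :
    gradient u z a = fderiv ℝ u z (EuclideanSpace.single a 1) := by
  have h := InnerProductSpace.toDual_symm_apply (𝕜 := ℝ) (x := EuclideanSpace.single a (1 : ℝ))
    (y := fderiv ℝ u z)
  rw [EuclideanSpace.inner_single_right] at h
  simpa [gradient] using h

namespace Network

variable {net : Network}

theorem forward_last (Λ : net.Weights) (x : net.Input) :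
    net.forward Λ x (Fin.last (net.hidden + 1)) = fun j => x j :=
  Fin.reverseInduction_last

theorem forward_castSucc (Λ : net.Weights) (x : net.Input) (i : Fin (net.hidden + 1)) :
    net.forward Λ x i.castSucc =
      fun j => net.activation i j (net.weightedSum Λ i (net.forward Λ x i.succ) j) :=
  Fin.reverseInduction_castSucc i

theorem eval_zero_weights (x : net.Input) : net.eval x 0 = 0 := by
  ext j
  have h := congrFun (forward_castSucc (0 : net.Weights) x 0) j
  refine h.trans ?_
  rw [show net.weightedSum 0 0 (net.forward 0 x (Fin.succ 0)) j = 0 by simp [weightedSum]]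
  rfl

theorem contDiff_activation (hσ : ∀ i j, ContDiff ℝ 2 (net.act i j)) (i : Fin (net.hidden + 1))
    (j : Fin (net.width i.castSucc)) : ContDiff ℝ 2 (net.activation i j) := by
  revert j
  refine Fin.cases ?_ ?_ i
  · exact fun j => contDiff_id
  · exact fun i j => hσ i j

theorem contDiff_forward (hσ : ∀ i j, ContDiff ℝ 2 (net.act i j)) (i : Fin (net.hidden + 2))
    (j : Fin (net.width i)) :
    ContDiff ℝ 2 fun p : net.Input × net.Weights => net.forward p.2 p.1 i j := by
  revert j
  refine Fin.reverseInduction ?_ ?_ i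
  · intro j
    simp only [forward_last]
    exact (EuclideanSpace.proj (𝕜 := ℝ) j).contDiff.comp contDiff_fst
  · intro i ih j
    simp only [forward_castSucc, weightedSum]
    refine (contDiff_activation hσ i j).comp (ContDiff.sum fun p _ => ContDiff.mul ?_ (ih p))
    exact (EuclideanSpace.proj (𝕜 := ℝ) (⟨i, (p, j)⟩ : net.Arrow)).contDiff.comp contDiff_snd

theorem contDiff_eval (hσ : ∀ i j, ContDiff ℝ 2 (net.act i j)) :
    ContDiff ℝ 2 fun p : net.Input × net.Weights => net.eval p.1 p.2 :=
  contDiff_euclidean.2 fun j => contDiff_forward hσ 0 j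

theorem contDiff_eval_right (hσ : ∀ i j, ContDiff ℝ 2 (net.act i j)) (x : net.Input) :
    ContDiff ℝ 2 (net.eval x) :=
  (contDiff_eval hσ).comp (contDiff_prodMk_right x)

theorem differentiable_forward (hσ : ∀ i j, ContDiff ℝ 2 (net.act i j)) (x : net.Input)
    (i : Fin (net.hidden + 2)) (j : Fin (net.width i)) :
    Differentiable ℝ fun Λ : net.Weights => net.forward Λ x i j :=
  ((contDiff_forward hσ i j).comp (contDiff_prodMk_right x)).differentiable (by norm_num)

/-- Forward propagation of the derivative in the direction `δ` of the weight space. -/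
theorem fderiv_forward_castSucc (hσ : ∀ i j, ContDiff ℝ 2 (net.act i j)) (x : net.Input)
    (Λ δ : net.Weights) (i : Fin (net.hidden + 1)) (j : Fin (net.width i.castSucc)) :
    fderiv ℝ (fun Λ' => net.forward Λ' x i.castSucc j) Λ δ =
      net.activationDeriv Λ x i j * ∑ p, (δ ⟨i, (p, j)⟩ * net.forward Λ x i.succ p +
        Λ ⟨i, (p, j)⟩ * fderiv ℝ (fun Λ' => net.forward Λ' x i.succ p) Λ δ) := by
  have hs : HasFDerivAt (fun Λ' => net.weightedSum Λ' i (net.forward Λ' x i.succ) j)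
      (∑ p, (Λ ⟨i, (p, j)⟩ • fderiv ℝ (fun Λ' => net.forward Λ' x i.succ p) Λ +
        net.forward Λ x i.succ p • EuclideanSpace.proj (𝕜 := ℝ) (⟨i, (p, j)⟩ : net.Arrow))) Λ := by
    refine HasFDerivAt.fun_sum fun p _ => HasFDerivAt.mul ?_
      (differentiable_forward hσ x i.succ p Λ).hasFDerivAt
    exact (EuclideanSpace.proj (𝕜 := ℝ) (⟨i, (p, j)⟩ : net.Arrow)).hasFDerivAt
  have ha := ((contDiff_activation hσ i j).differentiable (by norm_num)
    (net.weightedSum Λ i (net.forward Λ x i.succ) j)).hasDerivAt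
  simp only [forward_castSucc]
  have hc := ha.comp_hasFDerivAt Λ hs
  rw [show (fun Λ' => net.activation i j (net.weightedSum Λ' i (net.forward Λ' x i.succ) j)) =
    net.activation i j ∘ fun Λ' => net.weightedSum Λ' i (net.forward Λ' x i.succ) j from rfl,
    hc.fderiv]
  simp only [smul_apply, sum_apply, add_apply, PiLp.proj_apply, smul_eq_mul, activationDeriv]
  congr 1
  exact Finset.sum_congr rfl fun p _ => by ring

theorem backwardNode_succ (E : net.Output → net.Output → ℝ) (Λ : net.Weights)
    (x : net.Input) (y : net.Output) (i : Fin (net.hidden + 1)) :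
    net.backwardNode E Λ x y i.succ = fun j => ∑ j', net.backwardNode E Λ x y i.castSucc j' *
      net.activationDeriv Λ x i j' * Λ ⟨i, (j, j')⟩ :=
  Fin.induction_succ _ _ i

/-- Going one layer back, the pairing of the back-propagated node derivatives with the derivative
of forward propagation loses exactly the contribution of the weights between the two layers. -/
theorem sum_backwardNode_mul_fderiv_castSucc (hσ : ∀ i j, ContDiff ℝ 2 (net.act i j))
    (E : net.Output → net.Output → ℝ) (x : net.Input) (y : net.Output) (Λ δ : net.Weights)
    (i : Fin (net.hidden + 1)) :
    ∑ j, net.backwardNode E Λ x y i.castSucc j *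
        fderiv ℝ (fun Λ' => net.forward Λ' x i.castSucc j) Λ δ =
      ∑ q : Fin (net.width i.succ) × Fin (net.width i.castSucc),
        net.backwardWeight E Λ x y ⟨i, q⟩ * δ ⟨i, q⟩ +
      ∑ p, net.backwardNode E Λ x y i.succ p *
        fderiv ℝ (fun Λ' => net.forward Λ' x i.succ p) Λ δ := by
  simp only [fderiv_forward_castSucc hσ, backwardNode_succ, backwardWeight]
  rw [Fintype.sum_prod_type_right]
  simp only [Finset.sum_mul]
  conv_rhs => enter [2]; rw [Finset.sum_comm]
  rw [← Finset.sum_add_distrib]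
  refine Finset.sum_congr rfl fun j _ => ?_
  rw [Finset.mul_sum, Finset.mul_sum, ← Finset.sum_add_distrib]
  exact Finset.sum_congr rfl fun p _ => by ring

/-- Back-propagation computes the gradient of the error with respect to the weights. -/
theorem gradient_error_eval_apply (hσ : ∀ i j, ContDiff ℝ 2 (net.act i j))
    {E : net.Output → net.Output → ℝ} {y : net.Output} (hE : Differentiable ℝ fun z => E z y)
    (x : net.Input) (Λ : net.Weights) (a : net.Arrow) :
    gradient (fun Λ' => E (net.eval x Λ') y) Λ a = net.backwardWeight E Λ x y a := by
  classical
  set δ : net.Weights := EuclideanSpace.single a 1 with hδ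
  set T : Fin (net.hidden + 2) → ℝ := fun i => ∑ j, net.backwardNode E Λ x y i j *
    fderiv ℝ (fun Λ' => net.forward Λ' x i j) Λ δ with hT
  have hlast : T (Fin.last (net.hidden + 1)) = 0 := by simp [hT, forward_last]
  have htel : T 0 = ∑ b : net.Arrow, net.backwardWeight E Λ x y b * δ b := by
    rw [Fintype.sum_sigma]
    have h1 : ∑ i : Fin (net.hidden + 1), T i.castSucc = ∑ i : Fin (net.hidden + 1),
        (∑ q, net.backwardWeight E Λ x y ⟨i, q⟩ * δ ⟨i, q⟩) +
          ∑ i : Fin (net.hidden + 1), T i.succ := by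
      rw [← Finset.sum_add_distrib]
      exact Finset.sum_congr rfl fun i _ =>
        sum_backwardNode_mul_fderiv_castSucc hσ E x y Λ δ i
    have h2 := Fin.sum_univ_castSucc T
    rw [Fin.sum_univ_succ, hlast, h1] at h2
    linarith
  have hF : DifferentiableAt ℝ (net.eval x) Λ :=
    (contDiff_eval_right hσ x).differentiable (by norm_num) Λ
  have hT0 : fderiv ℝ (fun Λ' => E (net.eval x Λ') y) Λ δ = T 0 := by
    have hc := fderiv_comp Λ (hE (net.eval x Λ)) hF
    rw [show (fun Λ' => E (net.eval x Λ') y) = (fun z => E z y) ∘ net.eval x from rfl, hc,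
      ContinuousLinearMap.comp_apply]
    have hinner := InnerProductSpace.toDual_symm_apply (𝕜 := ℝ) (x := fderiv ℝ (net.eval x) Λ δ)
      (y := fderiv ℝ (fun z => E z y) (net.eval x Λ))
    rw [← hinner, PiLp.inner_apply]
    refine Finset.sum_congr rfl fun j _ => ?_
    have hcoord : fderiv ℝ (fun Λ' => net.forward Λ' x 0 j) Λ δ =
        (fderiv ℝ (net.eval x) Λ δ) j := by
      have := ((EuclideanSpace.proj (𝕜 := ℝ) j).hasFDerivAt.comp Λ hF.hasFDerivAt).fderiv
      exact congrArg (fun l => l δ) this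
    rw [hcoord, real_inner_comm]
    rfl
  rw [gradient_apply_eq_fderiv_single, ← hδ, hT0, htel]
  simp [hδ]

end Network

/-! ### Families of functions with locally uniformly Lipschitz gradients -/

theorem norm_gradient_eq_norm_fderiv {V : Type*} [NormedAddCommGroup V] [InnerProductSpace ℝ V]
    [CompleteSpace V] (u : V → ℝ) (v : V) : ‖gradient u v‖ = ‖fderiv ℝ u v‖ :=
  (InnerProductSpace.toDual ℝ V).symm.norm_map _

/-- The functions `f x`, for `x ∈ D`, are differentiable with gradients that are Lipschitz on
bounded sets, uniformly in `x`, and their values and gradients at the origin are bounded. -/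
structure UniformlySmoothOn {𝒳 V : Type*} [NormedAddCommGroup V] [InnerProductSpace ℝ V]
    [CompleteSpace V] (f : 𝒳 → V → ℝ) (D : Set 𝒳) : Prop where
  differentiable : ∀ x ∈ D, Differentiable ℝ (f x)
  lipschitz : ∀ r : ℝ, 0 < r → ∃ C : ℝ, 0 ≤ C ∧ ∀ x ∈ D, ∀ v w : V, ‖v‖ < r → ‖w‖ < r →
    ‖gradient (f x) v - gradient (f x) w‖ ≤ C * ‖v - w‖
  bound_zero : ∃ C : ℝ, ∀ x ∈ D, |f x 0| ≤ C ∧ ‖gradient (f x) 0‖ ≤ C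

namespace UniformlySmoothOn

variable {𝒳 V : Type*} [NormedAddCommGroup V] [InnerProductSpace ℝ V]

theorem exists_bound_gradient [CompleteSpace V] {f : 𝒳 → V → ℝ} {D : Set 𝒳}
    (hf : UniformlySmoothOn f D) {r : ℝ} (hr : 0 < r) :
    ∃ C : ℝ, 0 ≤ C ∧ ∀ x ∈ D, ∀ v : V, ‖v‖ < r → ‖gradient (f x) v‖ ≤ C := by
  obtain ⟨C, hC0, hC⟩ := hf.lipschitz r hr
  obtain ⟨B, hB⟩ := hf.bound_zero
  refine ⟨|B| + C * r, by positivity, fun x hx v hv => ?_⟩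
  have h1 := hC x hx v 0 hv (by simpa using hr)
  rw [sub_zero] at h1
  calc ‖gradient (f x) v‖ = ‖gradient (f x) 0 + (gradient (f x) v - gradient (f x) 0)‖ := by
        rw [add_sub_cancel]
    _ ≤ ‖gradient (f x) 0‖ + ‖gradient (f x) v - gradient (f x) 0‖ := norm_add_le _ _
    _ ≤ |B| + C * r := add_le_add ((hB x hx).2.trans (le_abs_self B))
        (h1.trans (mul_le_mul_of_nonneg_left hv.le hC0))

theorem exists_bound [CompleteSpace V] {f : 𝒳 → V → ℝ} {D : Set 𝒳}
    (hf : UniformlySmoothOn f D) (v : V) : ∃ C : ℝ, ∀ x ∈ D, |f x v| ≤ C := by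
  have hr : 0 < ‖v‖ + 1 := by positivity
  obtain ⟨C, -, hC⟩ := hf.exists_bound_gradient hr
  obtain ⟨B, hB⟩ := hf.bound_zero
  refine ⟨B + C * ‖v‖, fun x hx => ?_⟩
  have h1 := (convex_ball (0 : V) (‖v‖ + 1)).norm_image_sub_le_of_norm_fderiv_le (𝕜 := ℝ)
    (f := f x) (C := C) (x := 0) (y := v) (fun w _ => hf.differentiable x hx w)
    (fun w hw => by
      rw [← norm_gradient_eq_norm_fderiv]
      exact hC x hx w (by simpa using hw)) (by simpa using hr) (by simp)
  rw [sub_zero, Real.norm_eq_abs] at h1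
  have h2 := abs_add_le (f x 0) (f x v - f x 0)
  rw [add_sub_cancel] at h2
  linarith [(hB x hx).1]

theorem continuous_gradient [CompleteSpace V] {f : 𝒳 → V → ℝ} {D : Set 𝒳}
    (hf : UniformlySmoothOn f D) {x : 𝒳} (hx : x ∈ D) : Continuous (gradient (f x)) := by
  refine continuous_iff_continuousAt.2 fun v => ?_
  obtain ⟨C, hC0, hC⟩ := hf.lipschitz (‖v‖ + 1) (by positivity)
  have hl : LipschitzOnWith ⟨C, hC0⟩ (gradient (f x)) (Metric.ball 0 (‖v‖ + 1)) :=
    LipschitzOnWith.of_dist_le_mul fun a ha b hb => by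
      rw [dist_eq_norm, dist_eq_norm]
      exact hC x hx a b (by simpa using ha) (by simpa using hb)
  exact hl.continuousOn.continuousAt (Metric.isOpen_ball.mem_nhds (by simp))

theorem integrable [CompleteSpace V] [MeasurableSpace 𝒳] {μ : Measure 𝒳} [IsProbabilityMeasure μ]
    {f : 𝒳 → V → ℝ} {D : Set 𝒳} (hf : UniformlySmoothOn f D)
    (hD : ∀ᵐ x ∂μ, x ∈ D) (hm : ∀ v, AEMeasurable (fun x => f x v) μ) (v : V) :
    Integrable (fun x => f x v) μ := by
  obtain ⟨C, hC⟩ := hf.exists_bound v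
  refine Integrable.of_bound (hm v).aestronglyMeasurable C ?_
  filter_upwards [hD] with x hx using hC x hx

variable [FiniteDimensional ℝ V] [MeasurableSpace V] [BorelSpace V] [MeasurableSpace 𝒳]
  {μ : Measure 𝒳} {f : 𝒳 → V → ℝ} {D : Set 𝒳}

/-- Measurability of each `x ↦ f x v` outside of a null set that depends on `v` gives joint
measurability of the gradient outside of a single null set: countably many `v` determine
everything, by continuity. -/
theorem exists_measurable_indicator_gradient (hf : UniformlySmoothOn f D)
    (hD : ∀ᵐ x ∂μ, x ∈ D) (hm : ∀ v, AEMeasurable (fun x => f x v) μ) :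
    ∃ S ⊆ D, (∀ᵐ x ∂μ, x ∈ S) ∧
      Measurable (Function.uncurry fun v => S.indicator fun x => gradient (f x) v) := by
  classical
  set T : Set 𝒳 := {x | x ∈ D ∧ ∀ n, f x (TopologicalSpace.denseSeq V n) =
    (hm (TopologicalSpace.denseSeq V n)).mk _ x} with hT
  have hTae : ∀ᵐ x ∂μ, x ∈ T := by
    have := ae_all_iff.2 fun n => (hm (TopologicalSpace.denseSeq V n)).ae_eq_mk
    filter_upwards [hD, this] with x h1 h2 using ⟨h1, h2⟩
  set S : Set 𝒳 := (toMeasurable μ Tᶜ)ᶜ with hS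
  have hSm : MeasurableSet S := (measurableSet_toMeasurable μ _).compl
  have hST : S ⊆ T := Set.compl_subset_comm.1 (subset_toMeasurable μ Tᶜ)
  have hSD : S ⊆ D := fun x hx => (hST hx).1
  have hSae : ∀ᵐ x ∂μ, x ∈ S := by
    rw [ae_iff]
    have h0 : μ Tᶜ = 0 := ae_iff.1 hTae
    simpa [hS, measure_toMeasurable] using h0
  have hfm : ∀ v, Measurable (S.indicator fun x => f x v) := by
    intro v
    have hq : ∀ n, Measurable (S.indicator fun x => f x (TopologicalSpace.denseSeq V n)) := by
      intro n
      rw [Set.indicator_congr (g := (hm (TopologicalSpace.denseSeq V n)).mk _)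
        fun x hx => (hST hx).2 n]
      exact (hm (TopologicalSpace.denseSeq V n)).measurable_mk.indicator hSm
    obtain ⟨u, hu, hlim⟩ := mem_closure_iff_seq_limit.1
      ((TopologicalSpace.denseRange_denseSeq V).closure_range ▸ Set.mem_univ v)
    choose k hk using hu
    refine measurable_of_tendsto_metrizable (fun n => hq (k n)) (tendsto_pi_nhds.2 fun x => ?_)
    by_cases hx : x ∈ S
    · simp only [Set.indicator_of_mem hx, hk]
      exact ((hf.differentiable x (hSD hx)).continuous.tendsto v).comp hlim
    · simp only [Set.indicator_of_notMem hx]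
      exact tendsto_const_nhds
  have hdir : ∀ v δ, Measurable (S.indicator fun x => inner ℝ δ (gradient (f x) v)) := by
    intro v δ
    refine measurable_of_tendsto_metrizable (f := fun (n : ℕ) x => (n : ℝ) •
      (S.indicator (fun x => f x (v + (n : ℝ)⁻¹ • δ)) x - S.indicator (fun x => f x v) x))
      (fun n => ((hfm (v + (n : ℝ)⁻¹ • δ)).sub (hfm v)).const_smul (n : ℝ))
      (tendsto_pi_nhds.2 fun x => ?_)
    by_cases hx : x ∈ S
    · simp only [Set.indicator_of_mem hx]
      have := (hf.differentiable x (hSD hx) v).hasFDerivAt.lim δ (c := fun n : ℕ => (n : ℝ))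
        (l := atTop) (by simpa using tendsto_natCast_atTop_atTop)
      rwa [real_inner_comm, gradient, InnerProductSpace.toDual_symm_apply]
    · simp only [Set.indicator_of_notMem hx]
      simp
  refine ⟨S, hSD, hSae, measurable_uncurry_of_continuous_of_measurable (fun x => ?_) fun v => ?_⟩
  · by_cases hx : x ∈ S
    · simpa only [Set.indicator_of_mem hx] using hf.continuous_gradient (hSD hx)
    · simpa only [Set.indicator_of_notMem hx] using continuous_const
  · have hb : (S.indicator fun x => gradient (f x) v) = fun x => ∑ i,
        S.indicator (fun x => inner ℝ (stdOrthonormalBasis ℝ V i) (gradient (f x) v)) x •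
          stdOrthonormalBasis ℝ V i := by
      funext x
      by_cases hx : x ∈ S
      · simp only [Set.indicator_of_mem hx]
        exact ((stdOrthonormalBasis ℝ V).sum_repr' _).symm
      · simp [Set.indicator_of_notMem hx]
    rw [hb]
    exact Finset.measurable_sum _ fun i _ => (hdir v _).smul_const _

theorem aestronglyMeasurable_gradient (hf : UniformlySmoothOn f D)
    (hD : ∀ᵐ x ∂μ, x ∈ D) (hm : ∀ v, AEMeasurable (fun x => f x v) μ) (v : V) :
    AEStronglyMeasurable (fun x => gradient (f x) v) μ := by
  obtain ⟨S, -, hS, hSm⟩ := hf.exists_measurable_indicator_gradient hD hm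
  refine ⟨_, (hSm.comp measurable_prodMk_left : Measurable
    fun x => S.indicator (fun x => gradient (f x) v) x).stronglyMeasurable, ?_⟩
  filter_upwards [hS] with x hx
  exact (Set.indicator_of_mem hx fun x => gradient (f x) v).symm

theorem integrable_gradient [IsProbabilityMeasure μ] (hf : UniformlySmoothOn f D)
    (hD : ∀ᵐ x ∂μ, x ∈ D) (hm : ∀ v, AEMeasurable (fun x => f x v) μ) (v : V) :
    Integrable (fun x => gradient (f x) v) μ := by
  obtain ⟨C, -, hC⟩ := hf.exists_bound_gradient (r := ‖v‖ + 1) (by positivity)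
  refine Integrable.of_bound (hf.aestronglyMeasurable_gradient hD hm v) C ?_
  filter_upwards [hD] with x hx using hC x hx v (by simp)

/-- Differentiation under the integral sign. -/
theorem hasGradientAt_integral [IsProbabilityMeasure μ] (hf : UniformlySmoothOn f D)
    (hD : ∀ᵐ x ∂μ, x ∈ D) (hm : ∀ v, AEMeasurable (fun x => f x v) μ) (v : V) :
    HasGradientAt (fun w => ∫ x, f x w ∂μ) (∫ x, gradient (f x) v ∂μ) v := by
  obtain ⟨C, -, hC⟩ := hf.exists_bound_gradient (r := ‖v‖ + 1) (by positivity)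
  set T := (InnerProductSpace.toDual ℝ V).toContinuousLinearEquiv.toContinuousLinearMap with hT
  have key := hasFDerivAt_integral_of_dominated_of_fderiv_le (𝕜 := ℝ) (μ := μ)
    (F := fun w x => f x w) (F' := fun w x => T (gradient (f x) w)) (x₀ := v)
    (s := Metric.ball 0 (‖v‖ + 1)) (bound := fun _ => C)
    (Metric.isOpen_ball.mem_nhds (by simp))
    (Eventually.of_forall fun w => (hm w).aestronglyMeasurable)
    (hf.integrable hD hm v)
    (T.continuous.comp_aestronglyMeasurable (hf.aestronglyMeasurable_gradient hD hm v))
    (by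
      filter_upwards [hD] with x hx w hw
      exact ((InnerProductSpace.toDual ℝ V).norm_map _).trans_le (hC x hx w (by simpa using hw)))
    (integrable_const _)
    (by
      filter_upwards [hD] with x hx w _
      exact hasGradientAt_iff_hasFDerivAt.1 (hf.differentiable x hx w).hasGradientAt)
  rw [T.integral_comp_comm (hf.integrable_gradient hD hm v)] at key
  exact hasGradientAt_iff_hasFDerivAt.2 key

theorem norm_integral_gradient_sub_le [IsProbabilityMeasure μ] (hf : UniformlySmoothOn f D)
    (hD : ∀ᵐ x ∂μ, x ∈ D) (hm : ∀ v, AEMeasurable (fun x => f x v) μ) {v w : V} {C : ℝ}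
    (hC : ∀ x ∈ D, ‖gradient (f x) v - gradient (f x) w‖ ≤ C) :
    ‖(∫ x, gradient (f x) v ∂μ) - ∫ x, gradient (f x) w ∂μ‖ ≤ C := by
  rw [← integral_sub (hf.integrable_gradient hD hm v) (hf.integrable_gradient hD hm w)]
  have := norm_integral_le_of_norm_le_const (μ := μ) (hD.mono fun x hx => hC x hx)
  simpa using this

theorem continuous_integral_gradient [IsProbabilityMeasure μ] (hf : UniformlySmoothOn f D)
    (hD : ∀ᵐ x ∂μ, x ∈ D) (hm : ∀ v, AEMeasurable (fun x => f x v) μ) :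
    Continuous fun v => ∫ x, gradient (f x) v ∂μ := by
  refine continuous_iff_continuousAt.2 fun v => ?_
  obtain ⟨C, -, hC⟩ := hf.exists_bound_gradient (r := ‖v‖ + 1) (by positivity)
  refine continuousAt_of_dominated
    (Eventually.of_forall fun w => hf.aestronglyMeasurable_gradient hD hm w) (bound := fun _ => C)
    ?_ (integrable_const _) ?_
  · filter_upwards [Metric.isOpen_ball.mem_nhds
      (show v ∈ Metric.ball 0 (‖v‖ + 1) by simp)] with w hw
    filter_upwards [hD] with x hx using hC x hx w (by simpa using hw)
  · filter_upwards [hD] with x hx using (hf.continuous_gradient hx).continuousAt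

end UniformlySmoothOn

/-! ### Uniform estimates for the augmented error -/

theorem opNorm_le_card_mul_of_abs_single_le {m : ℕ} (l : EuclideanSpace ℝ (Fin m) →L[ℝ] ℝ)
    {C : ℝ} (hC : ∀ j, |l (EuclideanSpace.single j 1)| ≤ C) (hC0 : 0 ≤ C) : ‖l‖ ≤ m * C := by
  refine l.opNorm_le_bound (by positivity) fun δ => ?_
  have hδ : l δ = ∑ j, δ j * l (EuclideanSpace.single j 1) := by
    conv_lhs => rw [← (EuclideanSpace.basisFun (Fin m) ℝ).sum_repr δ]
    simp
  calc ‖l δ‖ ≤ ∑ j : Fin m, ‖δ‖ * C := by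
        rw [hδ]
        refine (norm_sum_le _ _).trans (Finset.sum_le_sum fun j _ => ?_)
        rw [norm_mul]
        exact mul_le_mul (PiLp.norm_apply_le δ j) (hC j) (norm_nonneg _) (norm_nonneg _)
    _ = m * C * ‖δ‖ := by simp; ring

theorem norm_comp_sub_comp_le {V W Z : Type*} [NormedAddCommGroup V] [NormedSpace ℝ V]
    [NormedAddCommGroup W] [NormedSpace ℝ W] [NormedAddCommGroup Z] [NormedSpace ℝ Z]
    (B B' : W →L[ℝ] Z) (A A' : V →L[ℝ] W) :
    ‖B.comp A - B'.comp A'‖ ≤ ‖B - B'‖ * ‖A‖ + ‖B'‖ * ‖A - A'‖ := by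
  have hsplit : B.comp A - B'.comp A' = (B - B').comp A + B'.comp (A - A') := by
    ext; simp
  rw [hsplit]
  exact (norm_add_le _ _).trans (add_le_add (ContinuousLinearMap.opNorm_comp_le _ _)
    (ContinuousLinearMap.opNorm_comp_le _ _))

theorem abs_le_sqrt_trace_transpose_mul_self {m : ℕ} (A : Matrix (Fin m) (Fin m) ℝ)
    (i j : Fin m) : |A i j| ≤ √(Matrix.trace (A.transpose * A)) := by
  refine Real.abs_le_sqrt ?_
  simp only [Matrix.trace, Matrix.diag_apply, Matrix.mul_apply, Matrix.transpose_apply, ← pow_two]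
  calc A i j ^ 2 ≤ ∑ i', A i' j ^ 2 :=
        Finset.single_le_sum (f := fun i' => A i' j ^ 2) (fun _ _ => sq_nonneg _)
          (Finset.mem_univ i)
    _ ≤ ∑ j', ∑ i', A i' j' ^ 2 :=
        Finset.single_le_sum (f := fun j' => ∑ i', A i' j' ^ 2)
          (fun _ _ => Finset.sum_nonneg fun _ _ => sq_nonneg _) (Finset.mem_univ j)

theorem C2BoundedError.exists_lipschitz_fderiv {m : ℕ}
    {E : EuclideanSpace ℝ (Fin m) → EuclideanSpace ℝ (Fin m) → ℝ} {G : ℝ}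
    (hE : C2BoundedError E G) {r : ℝ} (hr : 0 < r) :
    ∃ K : ℝ, 0 ≤ K ∧ ∀ y, ‖y‖ ≤ G → ∀ z z', ‖z‖ < r → ‖z'‖ < r →
      ‖fderiv ℝ (fun w => E w y) z - fderiv ℝ (fun w => E w y) z'‖ ≤ K * ‖z - z'‖ := by
  obtain ⟨Γ, hΓ, hb⟩ := hE.2 r hr
  refine ⟨m * (m * Γ), by positivity, fun y hy z z' hz hz' => ?_⟩
  have hH : ∀ w, ‖w‖ < r → ∀ i j, |hessian (fun w => E w y) w i j| ≤ Γ := fun w hw i j => by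
    have h1 := hb w y hw hy
    have h2 := abs_le_sqrt_trace_transpose_mul_self (hessian (fun w => E w y) w) i j
    linarith [abs_nonneg (E w y), norm_nonneg (gradient (fun w => E w y) w)]
  have hd : ∀ j : Fin m, Differentiable ℝ
      fun w => fderiv ℝ (fun w => E w y) w (EuclideanSpace.single j 1) := fun j =>
    (((hE.1 y hy).fderiv_right (m := 1) (by norm_num)).differentiable (by norm_num)).clm_apply
      (differentiable_const _)
  refine (opNorm_le_card_mul_of_abs_single_le _ (C := m * Γ * ‖z - z'‖) (fun j => ?_)
    (by positivity)).trans_eq (by ring)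
  exact (convex_ball (0 : EuclideanSpace ℝ (Fin m)) r).norm_image_sub_le_of_norm_fderiv_le (𝕜 := ℝ)
    (f := fun w => fderiv ℝ (fun w => E w y) w (EuclideanSpace.single j 1))
    (fun w _ => hd j w)
    (fun w hw => opNorm_le_card_mul_of_abs_single_le _
      (fun i => hH w (by simpa using hw) i j) hΓ.le) (by simpa using hz') (by simpa using hz)

namespace Network

variable {net : Network} {E : net.Output → net.Output → ℝ} {G : ℝ}

/-- For inputs, targets and weights in bounded sets, the gradient of the error is bounded and
Lipschitz in the weights: by the chain rule it is a product of two bounded Lipschitz functions,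
the derivative of `E` and that of the network, the latter being `C¹` in all variables. -/
theorem exists_bound_lipschitz_gradient_error (hσ : ∀ i j, ContDiff ℝ 2 (net.act i j))
    (hE : C2BoundedError E G) (s r : ℝ) :
    ∃ C : ℝ, 0 ≤ C ∧ ∀ (x : net.Input) (y : net.Output), ‖x‖ ≤ s → ‖y‖ ≤ G →
      ∀ Λ Λ' : net.Weights, ‖Λ‖ ≤ r → ‖Λ'‖ ≤ r →
        ‖gradient (fun Λ => E (net.eval x Λ) y) Λ‖ ≤ C ∧
        ‖gradient (fun Λ => E (net.eval x Λ) y) Λ - gradient (fun Λ => E (net.eval x Λ) y) Λ'‖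
          ≤ C * ‖Λ - Λ'‖ := by
  set F : net.Input × net.Weights → net.Output := fun p => net.eval p.1 p.2 with hF
  set A : net.Input × net.Weights → net.Weights →L[ℝ] net.Output :=
    fun p => (fderiv ℝ F p).comp (ContinuousLinearMap.inr ℝ net.Input net.Weights) with hA
  have hFc : ContDiff ℝ 2 F := contDiff_eval hσ
  have hAc : ContDiff ℝ 1 A :=
    (hFc.fderiv_right (m := 1) (by norm_num)).clm_comp contDiff_const
  have hAeq : ∀ x Λ, fderiv ℝ (net.eval x) Λ = A (x, Λ) := fun x Λ =>
    ((hFc.differentiable (by norm_num) (x, Λ)).hasFDerivAt.comp Λ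
      (hasFDerivAt_prodMk_right x Λ)).fderiv
  set K : Set (net.Input × net.Weights) := Metric.closedBall 0 s ×ˢ Metric.closedBall 0 r with hK
  have hKc : IsCompact K := (isCompact_closedBall _ _).prod (isCompact_closedBall _ _)
  have hKconv : Convex ℝ K := (convex_closedBall _ _).prod (convex_closedBall _ _)
  obtain ⟨b, hb⟩ := hKc.exists_bound_of_continuousOn hFc.continuous.continuousOn
  obtain ⟨a, ha⟩ := hKc.exists_bound_of_continuousOn hAc.continuous.continuousOn
  obtain ⟨lF, hlF⟩ := hFc.contDiffOn.exists_lipschitzOnWith (by norm_num) hKconv hKc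
  obtain ⟨lA, hlA⟩ := hAc.contDiffOn.exists_lipschitzOnWith (by norm_num) hKconv hKc
  have hr' : 0 < |b| + 1 := by positivity
  obtain ⟨Γ, hΓ, hEb⟩ := hE.2 _ hr'
  obtain ⟨L, hL, hEL⟩ := hE.exists_lipschitz_fderiv hr'
  refine ⟨|a| * Γ + (L * lF * |a| + Γ * lA), by positivity, fun x y hx hy Λ Λ' hΛ hΛ' => ?_⟩
  have hm : ((x, Λ) : net.Input × net.Weights) ∈ K := by simp [hK, hx, hΛ]
  have hm' : ((x, Λ') : net.Input × net.Weights) ∈ K := by simp [hK, hx, hΛ']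
  have hdist : dist ((x, Λ) : net.Input × net.Weights) (x, Λ') = ‖Λ - Λ'‖ := by
    simp [dist_eq_norm]
  have hz : ∀ {Λ}, ((x, Λ) : net.Input × net.Weights) ∈ K → ‖net.eval x Λ‖ < |b| + 1 :=
    fun h => ((hb _ h).trans (le_abs_self b)).trans_lt (lt_add_one _)
  have hfd : ∀ Λ, fderiv ℝ (fun Λ => E (net.eval x Λ) y) Λ =
      (fderiv ℝ (fun z => E z y) (net.eval x Λ)).comp (A (x, Λ)) := fun Λ => by
    rw [← hAeq]
    exact fderiv_comp Λ ((hE.1 y hy).differentiable (by norm_num) _)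
      ((contDiff_eval_right hσ x).differentiable (by norm_num) Λ)
  have hdE : ∀ {Λ}, ((x, Λ) : net.Input × net.Weights) ∈ K →
      ‖fderiv ℝ (fun z => E z y) (net.eval x Λ)‖ ≤ Γ := fun {Λ} h => by
    have h1 := hEb _ y (hz h) hy
    rw [← norm_gradient_eq_norm_fderiv]
    linarith [abs_nonneg (E (net.eval x Λ) y), Real.sqrt_nonneg (Matrix.trace
      ((hessian (fun w => E w y) (net.eval x Λ)).transpose *
        hessian (fun w => E w y) (net.eval x Λ)))]
  have hAb : ∀ {Λ}, ((x, Λ) : net.Input × net.Weights) ∈ K → ‖A (x, Λ)‖ ≤ |a| :=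
    fun h => (ha _ h).trans (le_abs_self a)
  constructor
  · rw [norm_gradient_eq_norm_fderiv, hfd]
    refine (ContinuousLinearMap.opNorm_comp_le _ _).trans ?_
    have := mul_le_mul (hdE hm) (hAb hm) (norm_nonneg _) hΓ.le
    have h0 : 0 ≤ L * lF * |a| + Γ * lA := by positivity
    linarith
  · have hFd : ‖net.eval x Λ - net.eval x Λ'‖ ≤ lF * ‖Λ - Λ'‖ := by
      have h1 := hlF.dist_le_mul _ hm _ hm'
      rwa [hdist, dist_eq_norm] at h1
    have hAd : ‖A (x, Λ) - A (x, Λ')‖ ≤ lA * ‖Λ - Λ'‖ := by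
      have h1 := hlA.dist_le_mul _ hm _ hm'
      rwa [hdist, dist_eq_norm] at h1
    have hg : ‖gradient (fun Λ => E (net.eval x Λ) y) Λ
        - gradient (fun Λ => E (net.eval x Λ) y) Λ'‖ =
        ‖fderiv ℝ (fun Λ => E (net.eval x Λ) y) Λ - fderiv ℝ (fun Λ => E (net.eval x Λ) y) Λ'‖ := by
      rw [gradient, gradient, ← map_sub, LinearIsometryEquiv.norm_map]
    rw [hg, hfd, hfd]
    have h1 := mul_le_mul ((hEL y hy _ _ (hz hm) (hz hm')).trans
      (mul_le_mul_of_nonneg_left hFd hL)) (hAb hm) (norm_nonneg _) (by positivity)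
    have h2 := mul_le_mul (hdE hm') hAd (norm_nonneg _) hΓ.le
    have h3 : 0 ≤ |a| * Γ * ‖Λ - Λ'‖ := by positivity
    refine (norm_comp_sub_comp_le _ _ _ _).trans ((add_le_add h1 h2).trans ?_)
    linarith

end Network

theorem gradient_add_eq {V : Type*} [NormedAddCommGroup V] [InnerProductSpace ℝ V]
    [CompleteSpace V] {u w : V → ℝ} {v : V} (hu : DifferentiableAt ℝ u v)
    (hw : DifferentiableAt ℝ w v) :
    gradient (fun v => u v + w v) v = gradient u v + gradient w v := by
  simp only [gradient]
  rw [fderiv_fun_add hu hw, map_add]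

namespace Network

variable {net : Network} {E : net.Output → net.Output → ℝ} {G : ℝ} {g : net.Input → net.Output}
  {α : net.Weights → ℝ} {D : Set net.Input}

theorem differentiable_error (hσ : ∀ i j, ContDiff ℝ 2 (net.act i j)) (hE : C2BoundedError E G)
    (x : net.Input) {y : net.Output} (hy : ‖y‖ ≤ G) :
    Differentiable ℝ fun Λ => E (net.eval x Λ) y :=
  ((hE.1 y hy).differentiable (by norm_num)).comp
    ((contDiff_eval_right hσ x).differentiable (by norm_num))

theorem gradient_augmentedError (hσ : ∀ i j, ContDiff ℝ 2 (net.act i j))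
    (hE : C2BoundedError E G) {x : net.Input} (hx : ‖g x‖ ≤ G) (hα : Differentiable ℝ α)
    (Λ : net.Weights) : gradient (net.augmentedError E g α x) Λ =
      gradient (fun Λ => E (net.eval x Λ) (g x)) Λ + gradient α Λ :=
  gradient_add_eq (differentiable_error hσ hE x hx Λ) (hα Λ)

/-- At zero weights the error is bounded even for unbounded inputs, because the output of the
network is then zero. -/
theorem exists_bound_augmentedError_zero (hE : C2BoundedError E G)
    (hg : ∀ x ∈ D, ‖g x‖ ≤ G) :
    ∃ C : ℝ, ∀ x ∈ D, |net.augmentedError E g α x 0| ≤ C := by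
  obtain ⟨Γ, -, hΓ⟩ := hE.2 1 one_pos
  refine ⟨Γ + |α 0|, fun x hx => (abs_add_le _ _).trans (add_le_add ?_ le_rfl)⟩
  rw [eval_zero_weights]
  have h1 := hΓ 0 (g x) (by simp) (hg x hx)
  linarith [norm_nonneg (gradient (fun w => E w (g x)) 0), Real.sqrt_nonneg (Matrix.trace
      ((hessian (fun w => E w (g x)) 0).transpose * hessian (fun w => E w (g x)) 0))]

theorem uniformlySmoothOn_augmentedError_of_bounded (hσ : ∀ i j, ContDiff ℝ 2 (net.act i j))
    (hE : C2BoundedError E G) (hg : ∀ x ∈ D, ‖g x‖ ≤ G)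
    (hα : net.IsAdequateAugmentation E g D α) {s : ℝ} (hs : ∀ x ∈ D, ‖x‖ ≤ s) :
    UniformlySmoothOn (net.augmentedError E g α) D where
  differentiable x hx := (differentiable_error hσ hE x (hg x hx)).add hα.differentiable
  lipschitz r hr := by
    obtain ⟨C, hC0, hC⟩ := exists_bound_lipschitz_gradient_error hσ hE s r
    obtain ⟨c, hc0, hc⟩ := hα.locallyLipschitz r hr
    refine ⟨C + c, by positivity, fun x hx Λ Λ' hΛ hΛ' => ?_⟩
    rw [gradient_augmentedError hσ hE (hg x hx) hα.differentiable,
      gradient_augmentedError hσ hE (hg x hx) hα.differentiable, add_sub_add_comm, add_mul]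
    exact (norm_add_le _ _).trans (add_le_add
      (hC x (g x) (hs x hx) (hg x hx) Λ Λ' hΛ.le hΛ'.le).2 (hc Λ Λ' hΛ.le hΛ'.le))
  bound_zero := by
    obtain ⟨C, hC0, hC⟩ := exists_bound_lipschitz_gradient_error hσ hE s 1
    obtain ⟨B, hB⟩ := exists_bound_augmentedError_zero (net := net) (α := α) hE hg
    refine ⟨max B (C + ‖gradient α 0‖), fun x hx => ⟨(hB x hx).trans (le_max_left _ _), ?_⟩⟩
    rw [gradient_augmentedError hσ hE (hg x hx) hα.differentiable]
    exact ((norm_add_le _ _).trans (add_le_add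
      (hC x (g x) (hs x hx) (hg x hx) 0 0 (by simp) (by simp)).1 le_rfl)).trans (le_max_right _ _)

theorem norm_gradient_le_of_gradientSup_le {R : ℝ} {c : ℝ≥0∞} (hc : c ≠ ∞)
    (h : net.gradientSup E g D α R ≤ c) {x : net.Input} (hx : x ∈ D) {Λ : net.Weights}
    (hΛ : ‖Λ‖ < R) : ‖gradient (net.augmentedError E g α x) Λ‖ ≤ c.toReal := by
  have h1 : ‖gradient (net.augmentedError E g α x) Λ‖ₑ ≤ c := by
    refine le_trans ?_ h
    refine le_trans ?_ (le_iSup₂ x hx)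
    exact le_iSup₂ (f := fun Λ (_ : Λ ∈ Metric.ball (0 : net.Weights) R) =>
      ‖gradient (net.augmentedError E g α x) Λ‖ₑ) Λ (by simpa using hΛ)
  have := ENNReal.toReal_mono hc h1
  simpa using this

theorem gradientSup_lt_top (h : UniformlySmoothOn (net.augmentedError E g α) D) {R : ℝ}
    (hR : 0 < R) : net.gradientSup E g D α R < ∞ := by
  obtain ⟨C, -, hC⟩ := h.exists_bound_gradient hR
  refine lt_of_le_of_lt (iSup₂_le fun x hx => iSup₂_le fun Λ hΛ => ?_)
    (ENNReal.ofReal_lt_top (r := C))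
  rw [← ofReal_norm]
  exact ENNReal.ofReal_le_ofReal (hC x hx Λ (by simpa using hΛ))

/-- The case of unbounded inputs, where the finiteness of the gradient supremum on any ball, however
small, bounds the gradients at the origin. -/
theorem uniformlySmoothOn_augmentedError_of_univ (hσ : ∀ i j, ContDiff ℝ 2 (net.act i j))
    (hE : C2BoundedError E G) (hg : ∀ x ∈ D, ‖g x‖ ≤ G) (hα : Differentiable ℝ α)
    {R : ℝ} (hR : 0 < R) (hfin : net.gradientSup E g D α R < ∞)
    (hlip : ∀ r : ℝ, 0 < r → ∃ M : ℝ, 0 < M ∧ ∀ (x : net.Input) (Λ Λ' : net.Weights),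
        ‖Λ‖ < r → ‖Λ'‖ < r →
          ‖gradient (net.augmentedError E g α x) Λ - gradient (net.augmentedError E g α x) Λ'‖
            ≤ M * ‖Λ - Λ'‖) :
    UniformlySmoothOn (net.augmentedError E g α) D where
  differentiable x hx := (differentiable_error hσ hE x (hg x hx)).add hα
  lipschitz r hr := by
    obtain ⟨M, hM0, hM⟩ := hlip r hr
    exact ⟨M, hM0.le, fun x _ => hM x⟩
  bound_zero := by
    obtain ⟨B, hB⟩ := exists_bound_augmentedError_zero (net := net) (α := α) hE hg
    exact ⟨max B (net.gradientSup E g D α R).toReal, fun x hx =>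
      ⟨(hB x hx).trans (le_max_left _ _), (norm_gradient_le_of_gradientSup_le hfin.ne le_rfl hx
        (by simpa using hR)).trans (le_max_right _ _)⟩⟩

end Network

/-! ### The iterates of back-propagation -/

/-- Steps of size at most `η k` whose direction does not point outwards beyond the radius `R₀`
keep the iterates inside of a fixed ball: beyond `R₀` the square of the norm grows by at most
`η k ^ 2`, and a step from within `R₀` ends at distance at most `R₀ + η k` from the origin. -/
theorem norm_lt_of_outward {V : Type*} [NormedAddCommGroup V] [InnerProductSpace ℝ V]
    {v d : ℕ → V} {η : ℕ → ℝ} {φ R₀ R : ℝ} (hη : ∀ k, 0 < η k)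
    (hηsq : Summable fun k => η k ^ 2) (hφ : 0 < φ) (hR₀ : 0 ≤ R₀)
    (hR : R = max (√(‖v 0‖ ^ 2 + ∑' k, η k ^ 2))
      (√(R₀ ^ 2 + 2 * (⨆ k, η k) * R₀ + ∑' k, η k ^ 2)))
    (hv : ∀ k, v (k + 1) = v k - (η k / φ) • d k) (hd : ∀ k, ‖v k‖ < R → ‖d k‖ ≤ φ)
    (hout : ∀ k, R₀ ≤ ‖v k‖ → 0 ≤ inner ℝ (v k) (d k)) (k : ℕ) : ‖v k‖ < R := by
  have hbdd : BddAbove (Set.range η) := by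
    obtain ⟨b, hb⟩ := hηsq.tendsto_atTop_zero.bddAbove_range
    refine ⟨b + 1, ?_⟩
    rintro _ ⟨k, rfl⟩
    have := hb ⟨k, rfl⟩
    nlinarith [sq_nonneg (η k - 1)]
  set A := max (‖v 0‖ ^ 2) (R₀ ^ 2 + 2 * (⨆ k, η k) * R₀) with hA
  have hlt : ∀ k, ‖v k‖ ^ 2 ≤ A + ∑ j ∈ Finset.range k, η j ^ 2 → ‖v k‖ < R := by
    intro k hk
    have h1 : ∑ j ∈ Finset.range k, η j ^ 2 < ∑' j, η j ^ 2 :=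
      (Finset.sum_range_succ (fun j => η j ^ 2) k ▸
        lt_add_of_pos_right _ (pow_pos (hη k) 2)).trans_le
          (hηsq.sum_le_tsum (Finset.range (k + 1)) fun _ _ => sq_nonneg _)
    rw [hR, lt_max_iff]
    rcases le_total (‖v 0‖ ^ 2) (R₀ ^ 2 + 2 * (⨆ k, η k) * R₀) with h | h
    · right
      rw [hA, max_eq_right h] at hk
      exact Real.lt_sqrt_of_sq_lt (by linarith)
    · left
      rw [hA, max_eq_left h] at hk
      exact Real.lt_sqrt_of_sq_lt (by linarith)
  suffices h : ∀ k, ‖v k‖ ^ 2 ≤ A + ∑ j ∈ Finset.range k, η j ^ 2 from hlt k (h k)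
  intro k
  induction k with
  | zero => simp [hA]
  | succ k ih =>
    have hdk := hd k (hlt k ih)
    have hstep : ‖(η k / φ) • d k‖ ≤ η k := by
      rw [norm_smul, Real.norm_of_nonneg (div_pos (hη k) hφ).le, div_mul_eq_mul_div,
        div_le_iff₀ hφ]
      exact mul_le_mul_of_nonneg_left hdk (hη k).le
    have hsum0 : 0 ≤ ∑ j ∈ Finset.range k, η j ^ 2 := Finset.sum_nonneg fun _ _ => sq_nonneg _
    rw [Finset.sum_range_succ, hv]
    rcases le_or_gt R₀ (‖v k‖) with hk | hk
    · rw [norm_sub_sq_real, inner_smul_right]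
      have h1 : 0 ≤ η k / φ * inner ℝ (v k) (d k) :=
        mul_nonneg (div_pos (hη k) hφ).le (hout k hk)
      have h2 : ‖(η k / φ) • d k‖ ^ 2 ≤ η k ^ 2 := pow_le_pow_left₀ (norm_nonneg _) hstep 2
      linarith
    · have h1 : ‖v k - (η k / φ) • d k‖ ≤ R₀ + η k :=
        (norm_sub_le _ _).trans (add_le_add hk.le hstep)
      have h2 : ‖v k - (η k / φ) • d k‖ ^ 2 ≤ (R₀ + η k) ^ 2 :=
        pow_le_pow_left₀ (norm_nonneg _) h1 2
      have h3 : η k * R₀ ≤ (⨆ k, η k) * R₀ := mul_le_mul_of_nonneg_right (le_ciSup hbdd k) hR₀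
      have h4 : R₀ ^ 2 + 2 * (⨆ k, η k) * R₀ ≤ A := le_max_right _ _
      nlinarith

namespace Network

variable {net : Network} {E : net.Output → net.Output → ℝ} {G : ℝ} {g : net.Input → net.Output}
  {α : net.Weights → ℝ}

theorem radius_pos {R₀ : ℝ} (hR₀ : 0 < R₀) {η : ℕ → ℝ} (hη : ∀ k, 0 < η k) (Λ₀ : net.Weights) :
    0 < net.radius Λ₀ R₀ η := by
  refine lt_max_of_lt_right (Real.sqrt_pos.2 ?_)
  have h1 : 0 ≤ ⨆ k, η k := Real.iSup_nonneg fun k => (hη k).le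
  have h2 : 0 ≤ ∑' k, η k ^ 2 := tsum_nonneg fun _ => sq_nonneg _
  positivity

/-- A step of back-propagation is a step of gradient descent for the augmented error. -/
theorem augmentedBP_succ (hσ : ∀ i j, ContDiff ℝ 2 (net.act i j)) (hE : C2BoundedError E G)
    (hα : Differentiable ℝ α) (η : ℕ → ℝ) (φ : ℝ) (Λ₀ : net.Weights) (x : ℕ → net.Input) (k : ℕ)
    (hx : ‖g (x k)‖ ≤ G) : net.augmentedBP E g α η φ Λ₀ x (k + 1) =
      net.augmentedBP E g α η φ Λ₀ x k - (η k / φ) •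
        gradient (net.augmentedError E g α (x k)) (net.augmentedBP E g α η φ Λ₀ x k) := by
  rw [gradient_augmentedError hσ hE hx hα]
  ext a
  rw [PiLp.sub_apply, PiLp.smul_apply, PiLp.add_apply,
    gradient_error_eval_apply hσ ((hE.1 _ hx).differentiable (by norm_num))]
  rfl

end Network

end BackProp

theorem proposition2p3
    {Ω : Type*} [MeasurableSpace Ω] (P : Measure Ω) [IsProbabilityMeasure P]
    (net : BackProp.Network) (hσ : net.UniformlyC2Bounded)
    -- the inputs, in the open ball of radius `ρ ∈ (0, ∞]`
    (ρ : ℝ≥0∞) (hρ : 0 < ρ)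
    (μ : Measure net.Input) [IsProbabilityMeasure μ]
    (hμ : ∀ᵐ x ∂μ, x ∈ Metric.eball (0 : net.Input) ρ)
    (X : ℕ → Ω → net.Input) (hX : ∀ k, Measurable (X k)) (hindep : iIndepFun X P)
    (hlaw : ∀ k, P.map (X k) = μ)
    -- the target and the error function
    (g : net.Input → net.Output) (G : ℝ) (hG : 0 < G)
    (hg : ∀ x ∈ Metric.eball (0 : net.Input) ρ, ‖g x‖ ≤ G)
    (E : net.Output → net.Output → ℝ) (hE : BackProp.C2BoundedError E G)
    (hmeas : ∀ Λ : net.Weights, AEMeasurable (fun x => E (net.eval x Λ) (g x)) μ)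
    -- the augmentation
    (α : net.Weights → ℝ)
    (hα : net.IsAdequateAugmentation E g (Metric.eball (0 : net.Input) ρ) α)
    (R₀ : ℝ) (hR₀ : 0 < R₀)
    (hout : ∀ x ∈ Metric.eball (0 : net.Input) ρ, ∀ Λ : net.Weights, R₀ ≤ ‖Λ‖ →
      0 ≤ inner ℝ Λ (gradient (net.augmentedError E g α x) Λ))
    -- the step sizes and the initial weights
    (η : ℕ → ℝ) (hη : ∀ k, 0 < η k) (hηsum : ¬ Summable η)
    (hηsq : Summable (fun k => η k ^ 2))
    (Λ₀ : net.Weights)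
    -- only for unbounded inputs: the gradient is bounded and locally Lipschitz uniformly in `x`
    (htop : ρ = ∞ →
      net.gradientSup E g (Metric.eball (0 : net.Input) ρ) α (net.radius Λ₀ R₀ η) < ∞ ∧
      ∀ r : ℝ, 0 < r → ∃ M : ℝ, 0 < M ∧ ∀ (x : net.Input) (Λ Λ' : net.Weights),
        ‖Λ‖ < r → ‖Λ'‖ < r →
          ‖gradient (net.augmentedError E g α x) Λ - gradient (net.augmentedError E g α x) Λ'‖
            ≤ M * ‖Λ - Λ'‖) :
    -- the supremum `Φ` is finite
    net.gradientSup E g (Metric.eball (0 : net.Input) ρ) α (net.radius Λ₀ R₀ η) < ∞ ∧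
    -- the mean error is well defined and differentiable
    (∀ Λ : net.Weights,
      IntegrableOn (fun x => E (net.eval x Λ) (g x)) (Metric.eball (0 : net.Input) ρ) μ) ∧
    Differentiable ℝ (net.meanError E g (Metric.eball (0 : net.Input) ρ) μ) ∧
    -- convergence of the algorithm
    ∀ φ : ℝ, 0 < φ →
      net.gradientSup E g (Metric.eball (0 : net.Input) ρ) α (net.radius Λ₀ R₀ η)
        ≤ ENNReal.ofReal φ →
      ∀ 𝓔 : net.Weights → ℝ, 𝓔 = net.meanError E g (Metric.eball (0 : net.Input) ρ) μ →
      ∀ Λ : ℕ → Ω → net.Weights,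
        (∀ k ω, Λ k ω = net.augmentedBP E g α η φ Λ₀ (fun i => X i ω) k) →
        (∀ᵐ ω ∂P, ∃ c : ℝ, Tendsto (fun k => 𝓔 (Λ k ω) + α (Λ k ω)) atTop (𝓝 c)) ∧
        (∀ᵐ ω ∂P, Tendsto (fun k => gradient 𝓔 (Λ k ω) + gradient α (Λ k ω)) atTop (𝓝 0)) ∧
        (∀ᵐ ω ∂P, ∀ L : net.Weights, MapClusterPt L atTop (fun k => Λ k ω) →
          gradient (fun Λ' => 𝓔 Λ' + α Λ') L = 0) := by
  classical
  set D : Set net.Input := Metric.eball (0 : net.Input) ρ with hD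
  set R := net.radius Λ₀ R₀ η with hRdef
  set f := net.augmentedError E g α with hf
  have hR : 0 < R := BackProp.Network.radius_pos hR₀ hη Λ₀
  have hU : BackProp.UniformlySmoothOn f D := by
    rcases eq_or_ne ρ ∞ with hρt | hρt
    · exact BackProp.Network.uniformlySmoothOn_augmentedError_of_univ hσ.1 hE hg hα.differentiable
        hR (htop hρt).1 (htop hρt).2
    · refine BackProp.Network.uniformlySmoothOn_augmentedError_of_bounded hσ.1 hE hg hα
        (s := ρ.toReal) fun x hx => ?_
      have h1 : ‖x‖ₑ < ρ := by simpa [hD, edist_zero_right] using hx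
      have h2 := ENNReal.toReal_mono hρt h1.le
      simpa using h2
  have hm : ∀ Λ, AEMeasurable (fun x => f x Λ) μ := fun Λ => (hmeas Λ).add_const (α Λ)
  have hint : ∀ Λ : net.Weights, Integrable (fun x => E (net.eval x Λ) (g x)) μ := fun Λ => by
    have := (hU.integrable hμ hm Λ).sub (integrable_const (α Λ))
    refine this.congr (ae_of_all _ fun x => ?_)
    simp [hf, BackProp.Network.augmentedError]
  have hmean : ∀ Λ, net.meanError E g D μ Λ = (∫ x, f x Λ ∂μ) - α Λ := fun Λ => by
    have h1 : ∫ x, f x Λ ∂μ = (∫ x, E (net.eval x Λ) (g x) ∂μ) + ∫ _, α Λ ∂μ :=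
      integral_add (hint Λ) (integrable_const _)
    rw [h1, BackProp.Network.meanError, Measure.restrict_eq_self_of_ae_mem hμ]
    simp
  have hgrad := hU.hasGradientAt_integral hμ hm
  have hdiff : Differentiable ℝ (net.meanError E g D μ) := by
    rw [funext hmean]
    exact fun Λ => (hgrad Λ).differentiableAt.sub (hα.differentiable Λ)
  refine ⟨BackProp.Network.gradientSup_lt_top hU hR, fun Λ => (hint Λ).integrableOn, hdiff, ?_⟩
  rintro φ hφ hΦ 𝓔 rfl Λ hΛ
  have hsum : ∀ L, net.meanError E g D μ L + α L = ∫ x, f x L ∂μ := fun L => by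
    rw [hmean, sub_add_cancel]
  have hgsum : ∀ L, gradient (fun L => net.meanError E g D μ L + α L) L
      = ∫ x, gradient (f x) L ∂μ := fun L => by
    rw [funext hsum]
    exact (hgrad L).gradient
  have hgadd : ∀ L, gradient (net.meanError E g D μ) L + gradient α L
      = ∫ x, gradient (f x) L ∂μ := fun L => by
    rw [← hgsum, BackProp.gradient_add_eq (hdiff L) (hα.differentiable L)]
  obtain ⟨S, hSD, hS, hSm⟩ := hU.exists_measurable_indicator_gradient hμ hm
  -- replacing the gradient by `0` for inputs outside of `S` makes it jointly measurable, and
  -- almost surely does not affect the iterates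
  set h : net.Weights → net.Input → net.Weights :=
    fun Λ => S.indicator fun x => gradient (f x) Λ with hh
  have hhS : ∀ Λ, ∀ x ∈ S, h Λ x = gradient (f x) Λ := fun Λ x hx =>
    Set.indicator_of_mem hx fun x => gradient (f x) Λ
  have hhS' : ∀ Λ, ∀ x ∉ S, h Λ x = 0 := fun Λ x hx =>
    Set.indicator_of_notMem hx fun x => gradient (f x) Λ
  have hhae : ∀ Λ, (fun x => gradient (f x) Λ) =ᵐ[μ] h Λ := fun Λ => by
    filter_upwards [hS] with x hx using (hhS Λ x hx).symm
  have hhint : ∀ Λ, ∫ x, h Λ x ∂μ = ∫ x, gradient (f x) Λ ∂μ := fun Λ =>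
    (integral_congr_ae (hhae Λ)).symm
  have hhb : ∀ Λ x, ‖Λ‖ < R → ‖h Λ x‖ ≤ φ := fun Λ x hΛR => by
    by_cases hx : x ∈ S
    · rw [hhS Λ x hx]
      have := BackProp.Network.norm_gradient_le_of_gradientSup_le ENNReal.ofReal_ne_top hΦ
        (hSD hx) hΛR
      rwa [ENNReal.toReal_ofReal hφ.le] at this
    · rw [hhS' Λ x hx, norm_zero]
      exact hφ.le
  set v : ℕ → Ω → net.Weights := fun k ω =>
    Nat.rec Λ₀ (fun k Λ => Λ - (η k / φ) • h Λ (X k ω)) k with hv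
  have hvR : ∀ k ω, ‖v k ω‖ < R := fun k ω => by
    refine BackProp.norm_lt_of_outward (v := fun k => v k ω) (d := fun k => h (v k ω) (X k ω))
      hη hηsq hφ hR₀.le rfl (fun _ => rfl) (fun k hk => hhb _ _ hk) (fun k hk => ?_) k
    by_cases hx : X k ω ∈ S
    · rw [hhS _ _ hx]
      exact hout _ (hSD hx) _ hk
    · rw [hhS' _ _ hx, inner_zero_right]
  have hXS : ∀ᵐ ω ∂P, ∀ k, X k ω ∈ S := ae_all_iff.2 fun k =>
    ae_of_ae_map (hX k).aemeasurable (by rw [hlaw k]; exact hS)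
  have hΛv : ∀ᵐ ω ∂P, ∀ k, Λ k ω = v k ω := by
    filter_upwards [hXS] with ω hω k
    rw [hΛ]
    induction k with
    | zero => rfl
    | succ k ih =>
      rw [BackProp.Network.augmentedBP_succ hσ.1 hE hα.differentiable η φ Λ₀ _ k
        (hg _ (hSD (hω k))), ih]
      change _ = v k ω - (η k / φ) • h (v k ω) (X k ω)
      rw [hhS _ _ (hω k)]
  obtain ⟨L, hL, hLip⟩ := hU.lipschitz R hR
  have hsgd := BackProp.ae_tendsto_of_stochastic_gradient_descent (P := P) (μ := μ) (h := h)
    (J := fun Λ => ∫ x, f x Λ ∂μ) (R := R) (L := L) (φ := φ) (η := fun k => η k / φ) (X := X)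
    (v := v) (v₀ := Λ₀) hSm (fun Λ => (hU.integrable_gradient hμ hm Λ).congr (hhae Λ))
    (fun Λ => by rw [hhint]; exact hgrad Λ) hL
    (fun a b ha hb => by
      rw [hhint, hhint]
      exact hU.norm_integral_gradient_sub_le hμ hm fun x hx => hLip x hx a b ha hb)
    hhb (fun k => (div_pos (hη k) hφ).le)
    (fun hs => hηsum (by simpa [div_mul_cancel₀ _ hφ.ne'] using hs.mul_right φ))
    (by simpa only [div_pow] using hηsq.div_const (φ ^ 2)) hX hindep hlaw (fun _ => rfl)
    (fun _ _ => rfl) hvR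
  simp only [hhint] at hsgd
  simp only [hsum, hgadd]
  refine ⟨?_, ?_, ?_⟩
  · filter_upwards [hsgd, hΛv] with ω h1 h2
    simpa only [h2] using h1.1
  · filter_upwards [hsgd, hΛv] with ω h1 h2
    simpa only [h2] using h1.2
  · filter_upwards [hsgd, hΛv] with ω h1 h2 L hL
    have h3 : Tendsto (fun k => ∫ x, gradient (f x) (Λ k ω) ∂μ) atTop (𝓝 0) := by
      simpa only [h2] using h1.2
    have h4 : MapClusterPt (∫ x, gradient (f x) L ∂μ) atTop
        fun k => ∫ x, gradient (f x) (Λ k ω) ∂μ :=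
      hL.continuousAt_comp (f := fun L => ∫ x, gradient (f x) L ∂μ)
        (hU.continuous_integral_gradient hμ hm).continuousAt
    have h5 : (𝓝 (∫ x, gradient (f x) L ∂μ) ⊓ 𝓝 0).NeBot := ClusterPt.mono h4 h3
    exact (hgrad L).gradient.trans (eq_of_nhds_neBot h5)
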